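/- Let $X,Y$ be real separable Hilbert spaces with their Borel $\sigma$-algebras (in particular $Y=\mathbb R^J$ is allowed) and let $\mathcal G_a:X\to Y$ be measurable. Let $x\in X$ and $\epsilon,\eta\in Y$ be random variables on a probability space such that $(\epsilon,x)$ is Gaussian on $Y\times X$, $\eta$ is centred Gaussian and $\eta$ is independent of $(\epsilon,x)$, and put $y=\mathcal G_a(x)+\epsilon+\eta$. Write $\bar x,\bar\epsilon$ for the means of $x$ and $\epsilon$; $\mathcal C_x,\mathcal C_\epsilon,\mathcal C_\eta$ for the covariance operators; $\mathcal C_{\epsilon x}=\mathbb E(\epsilon-\bar\epsilon)\otimes(x-\bar x)$, $\mathcal C_{x\epsilon}=\mathbb E(x-\bar x)\otimes(\epsilon-\bar\epsilon)$; $\mu_0=\mathcal N(\bar x,\mathcal C_x)$ for the law of $x$ (the prior) and $\mathbb Q_0=\mathcal N(0,\mathcal C_\eta)$ for the law of $\eta$. For $u\in X$ let $$\bar\nu_u=\bar\epsilon+\mathcal C_{\epsilon x}\mathcal C_x^{-1}(u-\bar x),\qquad \mathcal C_{\nu|x}=\mathcal C_\eta+\mathcal C_\epsilon-\mathcal C_{\epsilon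 x}\mathcal C_x^{-1}\mathcal C_{x\epsilon},\qquad h(u)=\mathcal G_a(u)+\bar\nu_u ,$$ where $\mathcal C_x^{-1}$ is read as the limit of $(\mathcal C_x+\delta I)^{-1}$ as $\delta\downarrow0$: the limit of $u\mapsto \mathcal C_{\epsilon x}(\mathcal C_x+\delta I)^{-1}(u-\bar x)$ is taken in $L^2(\mu_0;Y)$, so that $\bar\nu_u$ is determined for $\mu_0$-a.e. $u$, and that of $\mathcal C_{\epsilon x}(\mathcal C_x+\delta I)^{-1}\mathcal C_{x\epsilon}$ in operator norm. Let $\tilde{\mathbb Q}_u$ be the conditional law of $y$ given $x=u$, and let $\varsigma(du,dy)=\mu_0(du)\tilde{\mathbb Q}_u(dy)$ be the law of $(x,y)$. Assume that $\mathcal C_\eta$ and $\mathcal C_{\nu|x}$ commute, and that there are a complete orthonormal system $(e_k)$ of $Y$ and positive numbers $\lambda_k,r_k$ with $\mathcal C_\eta e_k=\lambda_ke_k$, $\mathcal C_{\nu|x}e_k=r_ke_k$ for all $k$, such that $$\sum_k\frac{\langle h(u),e_k\rangle^2}{\lambda_k+r_k}<\infty\ \text{ for $\mu_0$-a.e. }u,\qquad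 \sum_k\frac{(\lambda_k-r_k)^2}{(\lambda_k+r_k)^2}<\infty .$$ Let $\Phi:X\times Y\to\mathbb R$ be $\mu_0\otimes\mathbb Q_0$-measurable, and let $c:Y\to\mathbb R$ be $\mathbb Q_0$-measurable and positive $\mathbb Q_0$-a.s., such that for $\mu_0$-a.e. $u$ the Radon–Nikodym derivative (of the absolutely continuous part) satisfies $\frac{d\tilde{\mathbb Q}_u}{d\mathbb Q_0}(y)=\frac1{c(y)}e^{-\Phi(u;y)}$ for $\mathbb Q_0$-a.e. $y$. Assume $Z(y):=\int_X e^{-\Phi(u;y)}\mu_0(du)>0$ for $\mathbb Q_0$-a.e. $y$. Then, for $\mu_0$-a.e. $u$, $\tilde{\mathbb Q}_u=\mathcal N(h(u),\mathcal C_{\nu|x})$ and $\tilde{\mathbb Q}_u\ll\mathbb Q_0$. Moreover there is a Markov kernel $y\mapsto\mu^y$ from $Y$ to $X$ which is the conditional distribution of $x$ given $y$ under $\varsigma$ and such that, for $\varsigma$-a.s. $y$, $\mu^y\ll\mu_0$ and $$\frac{d\mu^y}{d\mu_0}(u)=\frac1{Z(y)}\exp(-\Phi(u;y)).\qquad(*)$$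 Suppose in addition that $\Phi$ satisfies the following: (i) for all $a,r>0$ there is $M\in\mathbb R$ with $\Phi(u;y)\ge M-a\|u\|^2$ for all $u\in X$ and all $\|y\|<r$; (ii) there is $p>0$ and for every $r>0$ a $K_1>0$ with $\Phi(u;y)\le K_1(1+\|u\|^p)$ for all $u\in X$ and all $\|y\|<r$; (iii) for every $r>0$ there is $K_2>0$ with $|\Phi(u_1;y)-\Phi(u_2;y)|\le K_2\|u_1-u_2\|$ whenever $\|u_1\|,\|u_2\|,\|y\|<r$; (iv) there is $q\ge0$ and for every $r>0$ a $K_3>0$ with $|\Phi(u;y_1)-\Phi(u;y_2)|\le K_3(1+\|u\|^q)\|y_1-y_2\|$ for all $u\in X$ and all $\|y_1\|,\|y_2\|<r$. Then the kernel can be chosen such that $(*)$ (with $\mu^y\ll\mu_0$) holds for every $y\in Y$, and it is Lipschitz in the data with respect to the Hellinger distance: for every $R>0$ there is $C=C(R)>0$ with $$d_{\mathrm{Hell}}(\mu^y,\mu^{y'})\le C\|y-y'\|\qquad\text{whenever }\|y\|,\|y'\|\le R,$$ where $d_{\mathrm{Hell}}(\mu,\mu')^2=\frac12\int\big(\sqrt{d\mu/d\rho}-\sqrt{d\mu'/d\rho}\big)^2d\rho$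 for a common reference measure $\rho$. -/

import Mathlib

open MeasureTheory ProbabilityTheory Filter Topology
open scoped ENNReal

namespace BayesModelError

noncomputable section

section Covariance

variable {Ω E F : Type*} [MeasurableSpace Ω]
  [NormedAddCommGroup E] [InnerProductSpace ℝ E]
  [NormedAddCommGroup F] [InnerProductSpace ℝ F]

/-- The (centred) covariance operator `C_{VU} = 𝔼 (V - 𝔼 V) ⊗ (U - 𝔼 U) : E → F`, that is
`C_{VU} u = 𝔼 [⟪U - 𝔼 U, u⟫ (V - 𝔼 V)]`, as a Bochner integral of rank-one operators. -/
def crossCov (U : Ω → E) (V : Ω → F) (P : Measure Ω) : E →L[ℝ] F :=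
  ∫ ω, (innerSL ℝ (U ω - ∫ ω', U ω' ∂P)).smulRight (V ω - ∫ ω', V ω' ∂P) ∂P

/-- The covariance operator `C_U = 𝔼 (U - 𝔼 U) ⊗ (U - 𝔼 U)`. -/
def covOp (U : Ω → E) (P : Measure Ω) : E →L[ℝ] E :=
  crossCov U U P

/-- `μ = N(a, C)`: a Gaussian measure with mean `a` and covariance operator `C`. -/
def IsGaussianWith [MeasurableSpace E] (μ : Measure E) (a : E) (C : E →L[ℝ] E) : Prop :=
  IsGaussian μ ∧ ∫ z, z ∂μ = a ∧ covOp (id : E → E) μ = C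

end Covariance

section Conditioning

variable {Ω X Y : Type*} [MeasurableSpace Ω]
  [NormedAddCommGroup X] [InnerProductSpace ℝ X] [MeasurableSpace X]
  [NormedAddCommGroup Y] [InnerProductSpace ℝ Y] [MeasurableSpace Y]

/-- `C_{εx} (C_x + δ I)⁻¹`, the bounded approximation of `C_{εx} C_x⁻¹` (the operator `C_x` is
compact, so that its inverse is unbounded when `X` is infinite dimensional). -/
def gain (x : Ω → X) (ε : Ω → Y) (P : Measure Ω) (δ : ℝ) : X →L[ℝ] Y :=
  crossCov x ε P ∘L Ring.inverse (covOp x P + δ • ContinuousLinearMap.id ℝ X)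

/-- `u ↦ C_{εx} C_x⁻¹ (u - 𝔼 x)` as a measurable function on `X`: the limit in `L²(μ₀; Y)`, with
`μ₀` the law of `x`, of `u ↦ C_{εx} (C_x + δ I)⁻¹ (u - 𝔼 x)` as `δ ↓ 0`. It is determined up to a
`μ₀`-null set. -/
def regression (x : Ω → X) (ε : Ω → Y) (P : Measure Ω) : X → Y :=
  Classical.epsilon fun m : X → Y ↦ Measurable m ∧
    Tendsto (fun δ : ℝ ↦ ∫⁻ u, ‖gain x ε P δ (u - ∫ ω, x ω ∂P) - m u‖ₑ ^ 2 ∂(P.map x))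
      (𝓝[>] 0) (𝓝 0)

/-- The conditional mean `𝔼 ε + C_{εx} C_x⁻¹ (u - 𝔼 x)` of `ε` (and of `ν = ε + η`, for centred
`η`) given `x = u`. -/
def condMean (x : Ω → X) (ε : Ω → Y) (P : Measure Ω) (u : X) : Y :=
  ∫ ω, ε ω ∂P + regression x ε P u

/-- The conditional covariance `C_{ε|x} = C_ε - C_{εx} C_x⁻¹ C_{xε}`, where `C_{εx} C_x⁻¹ C_{xε}`
is the limit, in operator norm, of `C_{εx} (C_x + δ I)⁻¹ C_{xε}` as `δ ↓ 0`. -/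
def condCov (x : Ω → X) (ε : Ω → Y) (P : Measure Ω) : Y →L[ℝ] Y :=
  covOp ε P - limUnder (𝓝[>] (0 : ℝ)) fun δ ↦ gain x ε P δ ∘L crossCov ε x P

/-- `C_{ν|x} = C_η + C_ε - C_{εx} C_x⁻¹ C_{xε}`, the conditional covariance of `ν = ε + η`. -/
def condNoiseCov (x : Ω → X) (ε η : Ω → Y) (P : Measure Ω) : Y →L[ℝ] Y :=
  covOp η P + condCov x ε P

end Conditioning

section Posterior

variable {X Y : Type*} [MeasurableSpace X]

/-- `Z(y) = ∫ exp (-Φ(u; y)) μ₀(du) ∈ [0, ∞]`. -/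
def evidence (Φ : X → Y → ℝ) (μ₀ : Measure X) (y : Y) : ℝ≥0∞ :=
  ∫⁻ u, ENNReal.ofReal (Real.exp (-Φ u y)) ∂μ₀

/-- The posterior measure at the data `y` is absolutely continuous with respect to the prior, with
density `exp (-Φ(u; y)) / Z(y)`. -/
def HasBayesDensity (μ : Measure X) (Φ : X → Y → ℝ) (μ₀ : Measure X) (y : Y) : Prop :=
  μ ≪ μ₀ ∧
    μ.rnDeriv μ₀ =ᵐ[μ₀] fun u ↦ ENNReal.ofReal (Real.exp (-Φ u y)) / evidence Φ μ₀ y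

/-- The Hellinger distance `(½ ∫ (√(dμ/dρ) - √(dμ'/dρ))² dρ) ^ (1/2)`, with the common reference
measure `ρ = μ + μ'`. -/
def hellingerDist (μ μ' : Measure X) : ℝ :=
  Real.sqrt ((1 / 2) * ∫ u, (Real.sqrt ((μ.rnDeriv (μ + μ') u).toReal)
    - Real.sqrt ((μ'.rnDeriv (μ + μ') u).toReal)) ^ 2 ∂(μ + μ'))

end Posterior

/-- The standing assumptions on the potential `Φ`. -/
structure PotentialBounds {X Y : Type*} [NormedAddCommGroup X] [NormedAddCommGroup Y]
    (Φ : X → Y → ℝ) : Prop where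
  lower : ∀ a > (0 : ℝ), ∀ r > (0 : ℝ), ∃ M : ℝ, ∀ (u : X) (y : Y), ‖y‖ < r → M - a * ‖u‖ ^ 2 ≤ Φ u y
  upper : ∃ p > (0 : ℝ), ∀ r > (0 : ℝ), ∃ K > (0 : ℝ), ∀ (u : X) (y : Y), ‖y‖ < r →
    Φ u y ≤ K * (1 + ‖u‖ ^ p)
  lipschitz_state : ∀ r > (0 : ℝ), ∃ K > (0 : ℝ), ∀ (u₁ u₂ : X) (y : Y),
    ‖u₁‖ < r → ‖u₂‖ < r → ‖y‖ < r → |Φ u₁ y - Φ u₂ y| ≤ K * ‖u₁ - u₂‖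
  lipschitz_data : ∃ q ≥ (0 : ℝ), ∀ r > (0 : ℝ), ∃ K > (0 : ℝ), ∀ (u : X) (y₁ y₂ : Y),
    ‖y₁‖ < r → ‖y₂‖ < r → |Φ u y₁ - Φ u y₂| ≤ K * (1 + ‖u‖ ^ q) * ‖y₁ - y₂‖

end

end BayesModelError

/-!
Given `x`, the model error `ε` splits into its regression on `x` and a Gaussian residual independent
of `x`, so `y` given `x = u` is Gaussian with mean `h(u)` and covariance `C_{ν|x}`; the regression
is an `L²` projection, which Tikhonov regularisation approximates. The density of this Gaussian law
with respect to `Q₀` is positive, so `Q₀` is absolutely continuous with respect to it, and the two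
laws are then equivalent by a zero-one law: a set carrying the singular part can be chosen, for each
`k`, independently of the coordinate along `e k`. Hence `(x, y)` has the density `exp (-Φ) / c` with
respect to `μ₀ ⊗ Q₀`, and Bayes' formula follows by disintegrating in the other order. For the
stability, the posterior at `y` has as square root density the normalisation in `L²(μ₀)` of
`exp (-Φ(·; y) / 2)`; Fernique's theorem makes this vector Lipschitz in `y`, and the upper bound on
`Φ` keeps its norm away from `0`.
-/

namespace BayesModelError

section Tikhonov

variable {H K : Type*} [NormedAddCommGroup H] [InnerProductSpace ℝ H] [CompleteSpace H]
  [NormedAddCommGroup K] [InnerProductSpace ℝ K] [CompleteSpace K]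

/-- The regularised normal operator `A† A + δ I` of the least squares problem for `A`. -/
noncomputable def tikhonovNormal (A : H →L[ℝ] K) (δ : ℝ) : H →L[ℝ] H :=
  A.adjoint ∘L A + δ • ContinuousLinearMap.id ℝ H

/-- `A (A† A + δ I)⁻¹ A†`, the Tikhonov approximation of the orthogonal projection onto the closure
of the range of `A`. -/
noncomputable def tikhonovProj (A : H →L[ℝ] K) (δ : ℝ) : K →L[ℝ] K :=
  A ∘L Ring.inverse (tikhonovNormal A δ) ∘L A.adjoint

theorem inner_tikhonovNormal_apply_self (A : H →L[ℝ] K) (δ : ℝ) (z : H) :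
    inner ℝ (tikhonovNormal A δ z) z = ‖A z‖ ^ 2 + δ * ‖z‖ ^ 2 := by
  simp only [tikhonovNormal, add_apply, ContinuousLinearMap.comp_apply, smul_apply,
    ContinuousLinearMap.id_apply, inner_add_left, ContinuousLinearMap.adjoint_inner_left,
    real_inner_smul_left, real_inner_self_eq_norm_sq]

theorem isUnit_tikhonovNormal (A : H →L[ℝ] K) {δ : ℝ} (hδ : 0 < δ) :
    IsUnit (tikhonovNormal A δ) := by
  refine ContinuousLinearMap.isUnit_of_forall_le_norm_inner_map _ (c := ⟨δ, hδ.le⟩) hδ fun z ↦ ?_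
  rw [inner_tikhonovNormal_apply_self, Real.norm_of_nonneg (by positivity), mul_comm]
  exact le_add_of_nonneg_left (sq_nonneg _)

theorem tikhonovNormal_inverse_apply (A : H →L[ℝ] K) {δ : ℝ} (hδ : 0 < δ) (w : H) :
    tikhonovNormal A δ (Ring.inverse (tikhonovNormal A δ) w) = w :=
  DFunLike.congr_fun (Ring.mul_inverse_cancel _ (isUnit_tikhonovNormal A hδ)) w

theorem isSelfAdjoint_tikhonovNormal (A : H →L[ℝ] K) (δ : ℝ) :
    IsSelfAdjoint (tikhonovNormal A δ) :=
  A.isPositive_adjoint_comp_self.isSelfAdjoint.add ((IsSelfAdjoint.all δ).smul (.one _))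

theorem norm_tikhonovProj_le (A : H →L[ℝ] K) {δ : ℝ} (hδ : 0 < δ) : ‖tikhonovProj A δ‖ ≤ 1 := by
  refine ContinuousLinearMap.opNorm_le_bound _ zero_le_one fun f ↦ ?_
  set z := Ring.inverse (tikhonovNormal A δ) (A.adjoint f) with hz
  have hself : inner ℝ f (A z) = ‖A z‖ ^ 2 + δ * ‖z‖ ^ 2 := by
    rw [← inner_tikhonovNormal_apply_self, hz, tikhonovNormal_inverse_apply A hδ,
      ContinuousLinearMap.adjoint_inner_left]
  have hcs : ‖A z‖ * ‖A z‖ ≤ ‖f‖ * ‖A z‖ := by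
    nlinarith [real_inner_le_norm f (A z), mul_nonneg hδ.le (sq_nonneg ‖z‖)]
  change ‖A z‖ ≤ 1 * ‖f‖
  rw [one_mul]
  by_contra! hlt
  exact hcs.not_gt (mul_lt_mul_of_pos_right hlt ((norm_nonneg f).trans_lt hlt))

theorem tikhonovProj_apply_range_sub (A : H →L[ℝ] K) {δ : ℝ} (hδ : 0 < δ) (w : H) :
    tikhonovProj A δ (A w) - A w = -(δ • A (Ring.inverse (tikhonovNormal A δ) w)) := by
  have hcancel : Ring.inverse (tikhonovNormal A δ) (tikhonovNormal A δ w) = w :=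
    DFunLike.congr_fun (Ring.inverse_mul_cancel _ (isUnit_tikhonovNormal A hδ)) w
  have hnormal : A.adjoint (A w) = tikhonovNormal A δ w - δ • w := by simp [tikhonovNormal]
  change A (Ring.inverse (tikhonovNormal A δ) (A.adjoint (A w))) - A w = _
  rw [hnormal, map_sub, hcancel, map_smul, map_sub, map_smul, sub_sub_cancel_left]

theorem norm_tikhonovProj_apply_range_sub_le (A : H →L[ℝ] K) {δ : ℝ} (hδ : 0 < δ) (w : H) :
    ‖tikhonovProj A δ (A w) - A w‖ ≤ √δ * ‖w‖ := by
  rw [tikhonovProj_apply_range_sub A hδ, norm_neg, norm_smul, Real.norm_of_nonneg hδ.le]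
  set z := Ring.inverse (tikhonovNormal A δ) w with hz
  have hself : inner ℝ w z = ‖A z‖ ^ 2 + δ * ‖z‖ ^ 2 := by
    rw [← inner_tikhonovNormal_apply_self, hz, tikhonovNormal_inverse_apply A hδ]
  have hsq : δ * ‖A z‖ ^ 2 ≤ ‖w‖ ^ 2 := by
    nlinarith [real_inner_le_norm w z, sq_nonneg (δ * ‖z‖ - ‖w‖), sq_nonneg (δ * ‖z‖),
      mul_nonneg hδ.le (norm_nonneg z)]
  refine le_of_sq_le_sq ?_ (by positivity)
  rw [mul_pow, mul_pow, Real.sq_sqrt hδ.le, sq δ, mul_assoc]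
  gcongr

theorem tendsto_tikhonovProj_apply_of_mem_range (A : H →L[ℝ] K) (w : H) :
    Tendsto (fun δ ↦ tikhonovProj A δ (A w)) (𝓝[>] 0) (𝓝 (A w)) := by
  rw [tendsto_iff_norm_sub_tendsto_zero]
  have hsqrt : Tendsto (fun δ : ℝ ↦ √δ * ‖w‖) (𝓝[>] 0) (𝓝 0) := by
    have h := (Real.continuous_sqrt.tendsto 0).mul_const ‖w‖
    rw [Real.sqrt_zero, zero_mul] at h
    exact h.mono_left nhdsWithin_le_nhds
  refine squeeze_zero' (.of_forall fun _ ↦ norm_nonneg _) ?_ hsqrt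
  filter_upwards [self_mem_nhdsWithin] with δ hδ using norm_tikhonovProj_apply_range_sub_le A hδ w

theorem tendsto_tikhonovProj_apply_of_mem_closure_range (A : H →L[ℝ] K) {g : K}
    (hg : g ∈ A.range.topologicalClosure) :
    Tendsto (fun δ ↦ tikhonovProj A δ g) (𝓝[>] 0) (𝓝 g) := by
  have hmap : (𝓝[>] (0 : ℝ)) =
      map (Subtype.val : Set.Ioi (0 : ℝ) → ℝ) (comap Subtype.val (𝓝 0)) := by
    rw [map_comap, Subtype.range_coe]; rfl
  have hequi : Equicontinuous fun (δ : Set.Ioi (0 : ℝ)) (f : K) ↦ tikhonovProj A δ f :=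
    (LipschitzWith.uniformEquicontinuous _ 1 fun δ : Set.Ioi (0 : ℝ) ↦
      (tikhonovProj A δ).lipschitz.weaken (norm_tikhonovProj_le A δ.2)).equicontinuous
  simp only [hmap, tendsto_map'_iff]
  refine closure_minimal ?_ (hequi.isClosed_setOfPred_tendsto continuous_id) hg
  rintro _ ⟨w, rfl⟩
  simpa only [hmap, tendsto_map'_iff] using! tendsto_tikhonovProj_apply_of_mem_range A w

theorem tikhonovProj_apply_of_mem_orthogonal_range (A : H →L[ℝ] K) (δ : ℝ) {g : K}
    (hg : g ∈ A.rangeᗮ) : tikhonovProj A δ g = 0 := by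
  have hker : A.adjoint g = 0 := by
    rwa [ContinuousLinearMap.orthogonal_range, LinearMap.mem_ker] at hg
  simp only [tikhonovProj, ContinuousLinearMap.comp_apply, hker, map_zero]

theorem tendsto_tikhonovProj_apply (A : H →L[ℝ] K) (f : K) :
    Tendsto (fun δ ↦ tikhonovProj A δ f) (𝓝[>] 0)
      (𝓝 (A.range.topologicalClosure.starProjection f)) := by
  set V := A.range.topologicalClosure
  have hsplit : ∀ δ, tikhonovProj A δ (V.starProjection f) = tikhonovProj A δ f := fun δ ↦ by
    have horth := tikhonovProj_apply_of_mem_orthogonal_range A δ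
      (Submodule.orthogonal_closure A.range ▸ V.sub_starProjection_mem_orthogonal f)
    rw [map_sub, sub_eq_zero] at horth
    exact horth.symm
  simpa only [hsplit] using
    tendsto_tikhonovProj_apply_of_mem_closure_range A (V.starProjection_apply_mem f)

end Tikhonov

section Pairing

variable {Ω E F ι κ : Type*} [MeasurableSpace Ω] {P : Measure Ω}
  [NormedAddCommGroup E] [InnerProductSpace ℝ E]
  [NormedAddCommGroup F] [InnerProductSpace ℝ F]

/-- The operator `v ↦ ⟪v, f⟫` from `E` to the real `L²` space attached to `f ∈ L²(P; E)`, as a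
bounded linear function of `f`. If `f` is the centred version of a random variable `U`, composing
this operator with its adjoint gives the covariance operator of `U`. -/
noncomputable def pairing (P : Measure Ω) : Lp E 2 P →L[ℝ] E →L[ℝ] Lp ℝ 2 P :=
  ((innerSL ℝ : E →L[ℝ] E →L[ℝ] ℝ).compLpL₂ 2 P).flip

theorem pairing_apply_ae (f : Lp E 2 P) (v : E) :
    pairing P f v =ᵐ[P] fun ω ↦ inner ℝ v (f ω) :=
  ContinuousLinearMap.coeFn_compLp _ _

theorem pairing_compLp [CompleteSpace E] [CompleteSpace F] (T : E →L[ℝ] F) (f : Lp E 2 P) :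
    pairing P (T.compLp f) = pairing P f ∘L T.adjoint := by
  ext1 v
  refine Lp.ext ?_
  filter_upwards [pairing_apply_ae (T.compLp f) v, T.coeFn_compLp f,
    pairing_apply_ae f (T.adjoint v)] with ω hT hcomp hadj
  rw [hT, hcomp, ContinuousLinearMap.comp_apply, hadj, ContinuousLinearMap.adjoint_inner_left]

theorem inner_pairing (f : Lp E 2 P) (g : Lp F 2 P) (u : E) (v : F) :
    inner ℝ (pairing P f u) (pairing P g v) = ∫ ω, inner ℝ u (f ω) * inner ℝ v (g ω) ∂P := by
  rw [L2.inner_def]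
  refine integral_congr_ae ?_
  filter_upwards [pairing_apply_ae f u, pairing_apply_ae g v] with ω hf hg
  rw [hf, hg, real_inner_comm]
  rfl

theorem countable_of_hilbertBasis [TopologicalSpace.SeparableSpace E] (e : HilbertBasis ι ℝ E) :
    Countable ι := by
  have hdisj : (Set.univ : Set ι).PairwiseDisjoint fun k ↦ Metric.ball (e k) (1 / 2) := by
    intro i _ j _ hij
    refine Metric.ball_disjoint_ball ?_
    have hdist : dist (e i) (e j) ^ 2 = 2 := by
      rw [dist_eq_norm, @norm_sub_sq ℝ, e.orthonormal.1 i, e.orthonormal.1 j, e.orthonormal.2 hij]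
      norm_num
    nlinarith [dist_nonneg (x := e i) (y := e j)]
  exact Set.countable_univ_iff.1 (hdisj.countable_of_isOpen (fun _ _ ↦ Metric.isOpen_ball)
    fun k _ ↦ ⟨e k, Metric.mem_ball_self (by norm_num)⟩)

theorem hasSum_inner_sq (e : HilbertBasis ι ℝ E) (v : E) :
    HasSum (fun k ↦ inner ℝ (e k) v ^ 2) (‖v‖ ^ 2) := by
  have h := e.hasSum_inner_mul_inner v v
  rw [real_inner_self_eq_norm_sq] at h
  refine h.congr_fun fun k ↦ ?_
  rw [real_inner_comm v, sq]

theorem hasSum_norm_pairing_sq [TopologicalSpace.SeparableSpace E] (e : HilbertBasis ι ℝ E)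
    (f : Lp E 2 P) : HasSum (fun k ↦ ‖pairing P f (e k)‖ ^ 2) (‖f‖ ^ 2) := by
  have := countable_of_hilbertBasis e
  have hcoord : ∀ k, Integrable (fun ω ↦ inner ℝ (e k) (f ω) ^ 2) P := fun k ↦
    ((Lp.memLp f).const_inner (e k)).integrable_sq
  have hnorm : Integrable (fun ω ↦ ‖f ω‖ ^ 2) P := (Lp.memLp f).integrable_norm_pow two_ne_zero
  have hsum : Summable fun k ↦ ∫ ω, ‖inner ℝ (e k) (f ω) ^ 2‖ ∂P := by
    refine summable_of_sum_le (c := ∫ ω, ‖f ω‖ ^ 2 ∂P)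
      (fun k ↦ integral_nonneg fun ω ↦ norm_nonneg _) fun s ↦ ?_
    rw [← integral_finsetSum _ fun k _ ↦ (hcoord k).norm]
    refine integral_mono (integrable_finsetSum _ fun k _ ↦ (hcoord k).norm) hnorm fun ω ↦ ?_
    simp only [Real.norm_of_nonneg (sq_nonneg _)]
    exact sum_le_hasSum s (fun k _ ↦ sq_nonneg _) (hasSum_inner_sq e (f ω))
  have h := hasSum_integral_of_summable_integral_norm hcoord hsum
  simp_rw [(hasSum_inner_sq e (f _)).tsum_eq] at h
  have hf : ‖f‖ ^ 2 = ∫ ω, ‖f ω‖ ^ 2 ∂P := by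
    rw [← real_inner_self_eq_norm_sq, L2.inner_def]
    simp_rw [real_inner_self_eq_norm_sq]
  rw [hf]
  refine h.congr_fun fun k ↦ ?_
  rw [← real_inner_self_eq_norm_sq, inner_pairing]
  simp_rw [sq]

theorem cauchy_map_of_tendsto_pairing [TopologicalSpace.SeparableSpace E] (e : HilbertBasis ι ℝ E)
    {l : Filter κ} [l.NeBot] {f : κ → Lp E 2 P} {g : ι → Lp ℝ 2 P} {b : ι → ℝ}
    (hb : Summable fun k ↦ b k ^ 2) (hle : ∀ᶠ n in l, ∀ k, ‖pairing P (f n) (e k)‖ ≤ b k)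
    (hlim : ∀ k, Tendsto (fun n ↦ pairing P (f n) (e k)) l (𝓝 (g k))) : Cauchy (map f l) := by
  rw [cauchy_map_iff', tendsto_uniformity_iff_dist_tendsto_zero]
  have hsq : Tendsto (fun p : κ × κ ↦
      ∑' k, ‖pairing P (f p.1) (e k) - pairing P (f p.2) (e k)‖ ^ 2)
      (l ×ˢ l) (𝓝 (∑' _ : ι, (0 : ℝ))) := by
    refine tendsto_tsum_of_dominated_convergence (hb.mul_left 4) (fun k ↦ ?_) ?_
    · have h := ((hlim k).comp tendsto_fst).sub ((hlim k).comp (tendsto_snd (f := l)))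
      simpa using h.norm.pow 2
    · filter_upwards [prod_mem_prod hle hle] with p hp k
      rw [Real.norm_of_nonneg (sq_nonneg _)]
      calc ‖pairing P (f p.1) (e k) - pairing P (f p.2) (e k)‖ ^ 2
          ≤ (b k + b k) ^ 2 := by
            gcongr; exact (norm_sub_le _ _).trans (add_le_add (hp.1 k) (hp.2 k))
        _ = 4 * b k ^ 2 := by ring
  rw [tsum_zero] at hsq
  have hdist := (Real.continuous_sqrt.tendsto 0).comp hsq
  rw [Real.sqrt_zero] at hdist
  refine hdist.congr fun p ↦ ?_
  have hparseval := (hasSum_norm_pairing_sq e (f p.1 - f p.2)).tsum_eq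
  simp only [map_sub, sub_apply] at hparseval
  rw [Function.comp_apply, hparseval, Real.sqrt_sq (norm_nonneg _), dist_eq_norm]

end Pairing

section CovarianceOperators

variable {Ω E F : Type*} [MeasurableSpace Ω] {P : Measure Ω}
  [NormedAddCommGroup E] [InnerProductSpace ℝ E]
  [NormedAddCommGroup F] [InnerProductSpace ℝ F]
  {U : Ω → E} {V : Ω → F}

theorem integrable_smulRight_innerSL (hU : MemLp U 2 P) (hV : MemLp V 2 P) :
    Integrable (fun ω ↦ (innerSL ℝ (U ω)).smulRight (V ω)) P := by
  have hcont : Continuous fun p : E × F ↦ (innerSL ℝ p.1).smulRight p.2 :=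
    (ContinuousLinearMap.smulRightL ℝ E F).continuous₂.comp
      (((innerSL ℝ).continuous.comp continuous_fst).prodMk continuous_snd)
  refine (hU.norm.integrable_mul hV.norm).mono'
    (hcont.comp_aestronglyMeasurable (hU.1.prodMk hV.1)) (ae_of_all _ fun ω ↦ ?_)
  rw [ContinuousLinearMap.norm_smulRight_apply, innerSL_apply_norm]
  rfl

variable [IsFiniteMeasure P]

/-- The centred random variable `U - 𝔼 U` as an element of `L²`. -/
noncomputable def centred (hU : MemLp U 2 P) : Lp E 2 P :=
  (hU.sub (memLp_const (∫ ω, U ω ∂P))).toLp (fun ω ↦ U ω - ∫ ω', U ω' ∂P)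

theorem centred_ae (hU : MemLp U 2 P) : centred hU =ᵐ[P] fun ω ↦ U ω - ∫ ω', U ω' ∂P :=
  MemLp.coeFn_toLp _

theorem inner_crossCov_eq_inner_pairing [CompleteSpace F] (hU : MemLp U 2 P) (hV : MemLp V 2 P)
    (u : E) (v : F) :
    inner ℝ v (crossCov U V P u)
      = inner ℝ (pairing P (centred hU) u) (pairing P (centred hV) v) := by
  have hint := integrable_smulRight_innerSL (hU.sub (memLp_const (∫ ω, U ω ∂P)))
    (hV.sub (memLp_const (∫ ω, V ω ∂P)))
  have happly := ContinuousLinearMap.integral_apply hint u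
  simp only [Pi.sub_apply] at happly hint
  rw [inner_pairing, crossCov, happly, ← integral_inner (hint.apply_continuousLinearMap u)]
  refine integral_congr_ae ?_
  filter_upwards [centred_ae hU, centred_ae hV] with ω hUω hVω
  rw [hUω, hVω, ContinuousLinearMap.smulRight_apply, innerSL_apply_apply, inner_smul_right,
    real_inner_comm u]

variable [CompleteSpace F]

theorem crossCov_eq_adjoint_comp (hU : MemLp U 2 P) (hV : MemLp V 2 P) :
    crossCov U V P = (pairing P (centred hV)).adjoint ∘L pairing P (centred hU) := by
  ext1 u
  refine ext_inner_left ℝ fun v ↦ ?_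
  rw [inner_crossCov_eq_inner_pairing hU hV, ContinuousLinearMap.comp_apply,
    ContinuousLinearMap.adjoint_inner_right, real_inner_comm]

theorem inner_crossCov [CompleteSpace E] (hU : MemLp U 2 P) (hV : MemLp V 2 P) (u : E) (v : F) :
    inner ℝ v (crossCov U V P u) = cov[fun ω ↦ inner ℝ u (U ω), fun ω ↦ inner ℝ v (V ω); P] := by
  rw [inner_crossCov_eq_inner_pairing hU hV, inner_pairing, covariance,
    integral_inner (hU.integrable one_le_two), integral_inner (hV.integrable one_le_two)]
  refine integral_congr_ae ?_
  filter_upwards [centred_ae hU, centred_ae hV] with ω hUω hVω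
  rw [hUω, hVω, inner_sub_right, inner_sub_right]

end CovarianceOperators

section GaussianLimit

variable {Ω E F κ : Type*} [MeasurableSpace Ω] {P : Measure Ω} {l : Filter κ}
  [NormedAddCommGroup E] [NormedSpace ℝ E] [NormedAddCommGroup F] [NormedSpace ℝ F]

theorem tendsto_eLpNorm_clm_comp {p : ℝ≥0∞} {Z : κ → Ω → E} {W : Ω → E} (L : E →L[ℝ] F)
    (h : Tendsto (fun n ↦ eLpNorm (Z n - W) p P) l (𝓝 0)) :
    Tendsto (fun n ↦ eLpNorm (L ∘ Z n - L ∘ W) p P) l (𝓝 0) := by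
  have hmul := ENNReal.Tendsto.const_mul h (.inr (ENNReal.ofReal_ne_top (r := ‖L‖)))
  rw [mul_zero] at hmul
  refine tendsto_of_tendsto_of_tendsto_of_le_of_le tendsto_const_nhds hmul (fun _ ↦ zero_le)
    fun n ↦ eLpNorm_le_mul_eLpNorm_of_ae_le_mul (ae_of_all _ fun ω ↦ ?_) p
  simp only [Pi.sub_apply, Function.comp_apply, ← map_sub]
  exact L.le_opNorm _

theorem charFunDual_map_eq_integral [MeasurableSpace E] [BorelSpace E] {V : Ω → E}
    (hV : AEMeasurable V P) (L : StrongDual ℝ E) :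
    charFunDual (P.map V) L = ∫ ω, Complex.exp ((L ∘ V) ω * Complex.I) ∂P := by
  rw [charFunDual_apply, integral_map hV (by fun_prop)]
  rfl

theorem norm_exp_mul_I_sub_exp_mul_I_le (s t : ℝ) :
    ‖Complex.exp (s * Complex.I) - Complex.exp (t * Complex.I)‖ ≤ ‖s - t‖ := by
  have hfactor : Complex.exp (s * Complex.I) - Complex.exp (t * Complex.I)
      = Complex.exp (t * Complex.I) * (Complex.exp (Complex.I * ((s - t : ℝ) : ℂ)) - 1) := by
    rw [mul_sub, ← Complex.exp_add]
    push_cast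
    ring_nf
  rw [hfactor, norm_mul, Complex.norm_exp_ofReal_mul_I, one_mul]
  exact Real.norm_exp_I_mul_ofReal_sub_one_le

variable [IsProbabilityMeasure P]

theorem tendsto_eLpNorm_one_of_two {G : Type*} [NormedAddCommGroup G] {Z : κ → Ω → G} {W : Ω → G}
    (hZ : ∀ n, MemLp (Z n) 2 P) (hW : MemLp W 2 P)
    (h : Tendsto (fun n ↦ eLpNorm (Z n - W) 2 P) l (𝓝 0)) :
    Tendsto (fun n ↦ eLpNorm (Z n - W) 1 P) l (𝓝 0) :=
  tendsto_of_tendsto_of_tendsto_of_le_of_le tendsto_const_nhds h (fun _ ↦ zero_le)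
    fun n ↦ eLpNorm_le_eLpNorm_of_exponent_le one_le_two ((hZ n).sub hW).1

theorem tendsto_integral_of_tendsto_eLpNorm_two {Z : κ → Ω → E} {W : Ω → E}
    (hZ : ∀ n, MemLp (Z n) 2 P) (hW : MemLp W 2 P)
    (h : Tendsto (fun n ↦ eLpNorm (Z n - W) 2 P) l (𝓝 0)) :
    Tendsto (fun n ↦ ∫ ω, Z n ω ∂P) l (𝓝 (∫ ω, W ω ∂P)) :=
  tendsto_integral_of_L1' W hW.1 (.of_forall fun n ↦ (hZ n).integrable one_le_two)
    (tendsto_eLpNorm_one_of_two hZ hW h)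

variable {a : κ → Ω → ℝ} {b : Ω → ℝ}

theorem tendsto_variance_of_tendsto_eLpNorm_two (ha : ∀ n, MemLp (a n) 2 P) (hb : MemLp b 2 P)
    (h : Tendsto (fun n ↦ eLpNorm (a n - b) 2 P) l (𝓝 0)) :
    Tendsto (fun n ↦ Var[a n; P]) l (𝓝 Var[b; P]) := by
  have hmean := tendsto_integral_of_tendsto_eLpNorm_two ha hb h
  have hnorm : ∀ {f : Ω → ℝ} (hf : MemLp f 2 P), ∫ ω, (f ^ 2) ω ∂P = ‖hf.toLp f‖ ^ 2 := by
    intro f hf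
    rw [← real_inner_self_eq_norm_sq, L2.inner_def]
    refine integral_congr_ae ?_
    filter_upwards [hf.coeFn_toLp] with ω hω
    rw [hω, real_inner_self_eq_norm_sq, Real.norm_eq_abs, sq_abs, Pi.pow_apply]
  have hlp := (Lp.tendsto_Lp_iff_tendsto_eLpNorm'' a ha b hb).2 h
  rw [variance_eq_sub hb, hnorm hb]
  refine Tendsto.congr (fun n ↦ ?_) ((hlp.norm.pow 2).sub (hmean.pow 2))
  rw [variance_eq_sub (ha n), hnorm (ha n)]

theorem tendsto_integral_exp_mul_I_of_tendsto_eLpNorm_two (ha : ∀ n, MemLp (a n) 2 P)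
    (hb : MemLp b 2 P) (h : Tendsto (fun n ↦ eLpNorm (a n - b) 2 P) l (𝓝 0)) :
    Tendsto (fun n ↦ ∫ ω, Complex.exp (a n ω * Complex.I) ∂P) l
      (𝓝 (∫ ω, Complex.exp (b ω * Complex.I) ∂P)) := by
  have hcont : Continuous fun t : ℝ ↦ Complex.exp (t * Complex.I) := by fun_prop
  have hint : ∀ n, Integrable (fun ω ↦ Complex.exp (a n ω * Complex.I)) P := fun n ↦
    (integrable_const (1 : ℝ)).mono' (hcont.comp_aestronglyMeasurable (ha n).1)
      (ae_of_all _ fun ω ↦ (Complex.norm_exp_ofReal_mul_I _).le)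
  refine tendsto_integral_of_L1' _ (hcont.comp_aestronglyMeasurable hb.1) (.of_forall hint) ?_
  exact tendsto_of_tendsto_of_tendsto_of_le_of_le tendsto_const_nhds
    (tendsto_eLpNorm_one_of_two ha hb h) (fun _ ↦ zero_le)
    fun n ↦ eLpNorm_mono fun ω ↦ norm_exp_mul_I_sub_exp_mul_I_le _ _

variable [MeasurableSpace E] [BorelSpace E]

theorem hasGaussianLaw_of_tendsto_eLpNorm_two [l.NeBot] {Z : κ → Ω → E} {W : Ω → E}
    (hZ : ∀ n, HasGaussianLaw (Z n) P) (hW : MemLp W 2 P)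
    (h : Tendsto (fun n ↦ eLpNorm (Z n - W) 2 P) l (𝓝 0)) : HasGaussianLaw W P := by
  rw [hasGaussianLaw_iff_charFunDual_map_eq hW.1.aemeasurable]
  intro L
  have hLZ : ∀ n, MemLp (L ∘ Z n) 2 P := fun n ↦ ((hZ n).map L).memLp_two
  have hLW : MemLp (L ∘ W) 2 P := L.comp_memLp' hW
  have hL := tendsto_eLpNorm_clm_comp L h
  have hmean := tendsto_integral_of_tendsto_eLpNorm_two hLZ hLW hL
  have hvar := tendsto_variance_of_tendsto_eLpNorm_two hLZ hLW hL
  have hchar : Tendsto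
      (fun n ↦ Complex.exp ((P[L ∘ Z n] : ℝ) * Complex.I - Var[L ∘ Z n; P] / 2)) l
      (𝓝 (Complex.exp ((P[L ∘ W] : ℝ) * Complex.I - Var[L ∘ W; P] / 2))) :=
    (((hmean.ofReal.mul_const _).sub (hvar.ofReal.div_const _))).cexp
  rw [charFunDual_map_eq_integral hW.1.aemeasurable]
  refine tendsto_nhds_unique (tendsto_integral_exp_mul_I_of_tendsto_eLpNorm_two hLZ hLW hL)
    (hchar.congr fun n ↦ ?_)
  rw [← (hZ n).charFunDual_map_eq, charFunDual_map_eq_integral (hZ n).aemeasurable]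

end GaussianLimit

section Gain

variable {Ω X Y : Type*} [MeasurableSpace Ω] {P : Measure Ω} [IsFiniteMeasure P]
  [NormedAddCommGroup X] [InnerProductSpace ℝ X]
  [NormedAddCommGroup Y] [InnerProductSpace ℝ Y]
  {x : Ω → X} {ε : Ω → Y}

theorem memLp_gain (hx : MemLp x 2 P) (δ : ℝ) :
    MemLp (fun ω ↦ gain x ε P δ (x ω - ∫ ω, x ω ∂P)) 2 P :=
  (gain x ε P δ).comp_memLp' (hx.sub (memLp_const _))

theorem toLp_gain (hx : MemLp x 2 P) (δ : ℝ) :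
    (memLp_gain (ε := ε) hx δ).toLp _ = (gain x ε P δ).compLp (centred hx) := by
  refine Lp.ext ?_
  filter_upwards [MemLp.coeFn_toLp (memLp_gain (ε := ε) hx δ),
    (gain x ε P δ).coeFn_compLp (centred hx), centred_ae hx] with ω htoLp hcomp hcentred
  rw [htoLp, hcomp, hcentred]

variable [CompleteSpace X] [CompleteSpace Y]

theorem gain_eq_adjoint_comp (hx : MemLp x 2 P) (hε : MemLp ε 2 P) (δ : ℝ) :
    gain x ε P δ = (pairing P (centred hε)).adjoint ∘L pairing P (centred hx) ∘L
      Ring.inverse (tikhonovNormal (pairing P (centred hx)) δ) := by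
  rw [gain, covOp, crossCov_eq_adjoint_comp hx hx, crossCov_eq_adjoint_comp hx hε]
  rfl

theorem gain_comp_crossCov (hx : MemLp x 2 P) (hε : MemLp ε 2 P) (δ : ℝ) :
    gain x ε P δ ∘L crossCov ε x P = (pairing P (centred hε)).adjoint ∘L
      tikhonovProj (pairing P (centred hx)) δ ∘L pairing P (centred hε) := by
  rw [gain_eq_adjoint_comp hx hε, crossCov_eq_adjoint_comp hε hx]
  rfl

theorem pairing_gain_compLp (hx : MemLp x 2 P) (hε : MemLp ε 2 P) (δ : ℝ) :
    pairing P ((gain x ε P δ).compLp (centred hx))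
      = tikhonovProj (pairing P (centred hx)) δ ∘L pairing P (centred hε) := by
  rw [pairing_compLp, gain_eq_adjoint_comp hx hε, ContinuousLinearMap.adjoint_comp,
    ContinuousLinearMap.adjoint_comp, (isSelfAdjoint_tikhonovNormal _ δ).ringInverse.adjoint_eq,
    ContinuousLinearMap.adjoint_adjoint]
  rfl

theorem cauchy_map_gain_compLp [TopologicalSpace.SeparableSpace Y] (hx : MemLp x 2 P)
    (hε : MemLp ε 2 P) :
    Cauchy (map (fun δ ↦ (gain x ε P δ).compLp (centred hx)) (𝓝[>] (0 : ℝ))) := by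
  obtain ⟨_, e, -⟩ := exists_hilbertBasis ℝ Y
  refine cauchy_map_of_tendsto_pairing e
    (g := fun k ↦ (pairing P (centred hx)).range.topologicalClosure.starProjection
      (pairing P (centred hε) (e k)))
    (hasSum_norm_pairing_sq e (centred hε)).summable ?_ fun k ↦ ?_
  · filter_upwards [self_mem_nhdsWithin] with δ hδ k
    rw [pairing_gain_compLp hx hε]
    exact (ContinuousLinearMap.le_of_opNorm_le _
      (norm_tikhonovProj_le (pairing P (centred hx)) hδ) _).trans_eq (one_mul _)
  · simp only [pairing_gain_compLp hx hε]
    exact tendsto_tikhonovProj_apply (pairing P (centred hx)) (pairing P (centred hε) (e k))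

end Gain

section LintegralSquare

variable {α E κ : Type*} [MeasurableSpace α] [NormedAddCommGroup E] {μ : Measure α}

theorem lintegral_enorm_sq_eq_eLpNorm_sq (f : α → E) :
    ∫⁻ a, ‖f a‖ₑ ^ 2 ∂μ = eLpNorm f 2 μ ^ 2 := by
  have h := eLpNorm_nnreal_pow_eq_lintegral (μ := μ) (f := f) (p := 2) two_ne_zero
  simpa using h.symm

theorem tendsto_lintegral_enorm_sq_iff_tendsto_eLpNorm {l : Filter κ} {f : κ → α → E} :
    Tendsto (fun n ↦ ∫⁻ a, ‖f n a‖ₑ ^ 2 ∂μ) l (𝓝 0) ↔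
      Tendsto (fun n ↦ eLpNorm (f n) 2 μ) l (𝓝 0) := by
  simp_rw [lintegral_enorm_sq_eq_eLpNorm_sq]
  refine ⟨fun h ↦ ?_, fun h ↦ by simpa using ENNReal.Tendsto.pow (n := 2) h⟩
  have hroot := ((ENNReal.continuous_rpow_const (y := (1 / 2 : ℝ))).tendsto 0).comp h
  rw [ENNReal.zero_rpow_of_pos (by norm_num)] at hroot
  refine hroot.congr fun n ↦ ?_
  rw [Function.comp_apply, ← ENNReal.rpow_natCast, ← ENNReal.rpow_mul]
  norm_num

end LintegralSquare

section Regression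

variable {Ω X Y : Type*} [MeasurableSpace Ω] {P : Measure Ω} [IsFiniteMeasure P]
  [NormedAddCommGroup X] [InnerProductSpace ℝ X] [CompleteSpace X]
  [SecondCountableTopology X] [MeasurableSpace X] [BorelSpace X]
  [NormedAddCommGroup Y] [InnerProductSpace ℝ Y] [CompleteSpace Y]
  [SecondCountableTopology Y] [MeasurableSpace Y] [BorelSpace Y]
  {x : Ω → X} {ε : Ω → Y}

theorem exists_tendsto_lintegral_gain_sub (hxm : Measurable x) (hx : MemLp x 2 P)
    (hε : MemLp ε 2 P) : ∃ m : X → Y, Measurable m ∧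
      Tendsto (fun δ : ℝ ↦ ∫⁻ u, ‖gain x ε P δ (u - ∫ ω, x ω ∂P) - m u‖ₑ ^ 2 ∂(P.map x))
        (𝓝[>] 0) (𝓝 0) := by
  have hmp : MeasurePreserving x P (P.map x) := hxm.measurePreserving P
  have hid : MemLp (fun u : X ↦ u) 2 (P.map x) :=
    (memLp_map_measure_iff (by fun_prop) hxm.aemeasurable).2 hx
  have hf : ∀ δ, MemLp (fun u ↦ gain x ε P δ (u - ∫ ω, x ω ∂P)) 2 (P.map x) := fun δ ↦
    (gain x ε P δ).comp_memLp' (hid.sub (memLp_const _))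
  have hpull : ∀ δ, Lp.compMeasurePreserving x hmp ((hf δ).toLp _)
      = (gain x ε P δ).compLp (centred hx) := fun δ ↦
    (Lp.toLp_compMeasurePreserving (hf δ) hmp).trans (toLp_gain hx δ)
  have hcauchy : Cauchy (map (fun δ ↦ (hf δ).toLp _) (𝓝[>] (0 : ℝ))) := by
    rw [← (Lp.isometry_compMeasurePreserving hmp).isUniformInducing.cauchy_map_iff, map_map]
    refine (cauchy_map_gain_compLp hx hε).mono' inferInstance (le_of_eq ?_)
    exact congrArg (fun g ↦ map g (𝓝[>] (0 : ℝ))) (funext hpull)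
  obtain ⟨W, hW⟩ := cauchy_map_iff_exists_tendsto.1 hcauchy
  refine ⟨W, (Lp.stronglyMeasurable W).measurable,
    tendsto_lintegral_enorm_sq_iff_tendsto_eLpNorm.2 ?_⟩
  rw [← Lp.toLp_coeFn W (Lp.memLp W)] at hW
  exact (Lp.tendsto_Lp_iff_tendsto_eLpNorm'' _ hf _ (Lp.memLp W)).1 hW

theorem measurable_regression (hxm : Measurable x) (hx : MemLp x 2 P) (hε : MemLp ε 2 P) :
    Measurable (regression x ε P) :=
  (Classical.epsilon_spec (exists_tendsto_lintegral_gain_sub hxm hx hε)).1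

theorem tendsto_lintegral_gain_sub_regression (hxm : Measurable x) (hx : MemLp x 2 P)
    (hε : MemLp ε 2 P) :
    Tendsto (fun δ : ℝ ↦ ∫⁻ u, ‖gain x ε P δ (u - ∫ ω, x ω ∂P) - regression x ε P u‖ₑ ^ 2
      ∂(P.map x)) (𝓝[>] 0) (𝓝 0) :=
  (Classical.epsilon_spec (exists_tendsto_lintegral_gain_sub hxm hx hε)).2

theorem tendsto_eLpNorm_gain_sub_regression (hxm : Measurable x) (hx : MemLp x 2 P)
    (hε : MemLp ε 2 P) :
    Tendsto (fun δ : ℝ ↦ eLpNorm ((fun ω ↦ gain x ε P δ (x ω - ∫ ω, x ω ∂P))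
      - fun ω ↦ regression x ε P (x ω)) 2 P) (𝓝[>] 0) (𝓝 0) := by
  have hm := measurable_regression hxm hx hε
  refine (tendsto_lintegral_enorm_sq_iff_tendsto_eLpNorm.1
    (tendsto_lintegral_gain_sub_regression hxm hx hε)).congr fun δ ↦ ?_
  rw [eLpNorm_map_measure (by fun_prop) hxm.aemeasurable]
  rfl

theorem memLp_regression (hxm : Measurable x) (hx : MemLp x 2 P) (hε : MemLp ε 2 P) :
    MemLp (fun ω ↦ regression x ε P (x ω)) 2 P := by
  obtain ⟨δ, hδ⟩ := ((tendsto_eLpNorm_gain_sub_regression hxm hx hε).eventually_lt_const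
    ENNReal.zero_lt_top).exists
  have hdiff : MemLp ((fun ω ↦ gain x ε P δ (x ω - ∫ ω, x ω ∂P))
      - fun ω ↦ regression x ε P (x ω)) 2 P :=
    ⟨(memLp_gain hx δ).1.sub
      ((measurable_regression hxm hx hε).comp hxm).aestronglyMeasurable, hδ⟩
  simpa using (memLp_gain (ε := ε) hx δ).sub hdiff

theorem tendsto_gain_compLp (hxm : Measurable x) (hx : MemLp x 2 P) (hε : MemLp ε 2 P) :
    Tendsto (fun δ ↦ (gain x ε P δ).compLp (centred hx)) (𝓝[>] (0 : ℝ))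
      (𝓝 ((memLp_regression hxm hx hε).toLp _)) :=
  ((Lp.tendsto_Lp_iff_tendsto_eLpNorm'' _ (memLp_gain (ε := ε) hx) _
    (memLp_regression hxm hx hε)).2 (tendsto_eLpNorm_gain_sub_regression hxm hx hε)).congr
      fun δ ↦ toLp_gain hx δ

theorem pairing_regression (hxm : Measurable x) (hx : MemLp x 2 P) (hε : MemLp ε 2 P) :
    pairing P ((memLp_regression hxm hx hε).toLp _)
      = (pairing P (centred hx)).range.topologicalClosure.starProjection
        ∘L pairing P (centred hε) := by
  ext1 v
  have hregression := (((pairing P).flip v).continuous.tendsto _).comp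
    (tendsto_gain_compLp hxm hx hε)
  refine tendsto_nhds_unique hregression ((tendsto_tikhonovProj_apply
    (pairing P (centred hx)) (pairing P (centred hε) v)).congr fun δ ↦ ?_)
  simp only [Function.comp_apply, ContinuousLinearMap.flip_apply, pairing_gain_compLp hx hε,
    ContinuousLinearMap.comp_apply]

theorem tendsto_gain_comp_crossCov (hxm : Measurable x) (hx : MemLp x 2 P) (hε : MemLp ε 2 P) :
    Tendsto (fun δ ↦ gain x ε P δ ∘L crossCov ε x P) (𝓝[>] (0 : ℝ))
      (𝓝 ((pairing P (centred hε)).adjoint ∘L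
        (pairing P (centred hx)).range.topologicalClosure.starProjection
          ∘L pairing P (centred hε))) := by
  have hpairing := ((pairing P).continuous.tendsto _).comp (tendsto_gain_compLp hxm hx hε)
  rw [pairing_regression hxm hx hε] at hpairing
  refine (((ContinuousLinearMap.compL ℝ Y (Lp ℝ 2 P) Y
    (pairing P (centred hε)).adjoint).continuous.tendsto _).comp hpairing).congr fun δ ↦ ?_
  rw [gain_comp_crossCov hx hε, Function.comp_apply, Function.comp_apply,
    pairing_gain_compLp hx hε]
  rfl

/-- The residual `ε - 𝔼[ε | x]` of the regression of `ε` on `x`. -/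
noncomputable def residual (x : Ω → X) (ε : Ω → Y) (P : Measure Ω) (ω : Ω) : Y :=
  ε ω - condMean x ε P (x ω)

theorem measurable_residual (hxm : Measurable x) (hεm : Measurable ε) (hx : MemLp x 2 P)
    (hε : MemLp ε 2 P) : Measurable (residual x ε P) :=
  hεm.sub (((measurable_regression hxm hx hε).comp hxm).const_add _)

theorem memLp_condMean (hxm : Measurable x) (hx : MemLp x 2 P) (hε : MemLp ε 2 P) :
    MemLp (fun ω ↦ condMean x ε P (x ω)) 2 P :=
  (memLp_const (∫ ω, ε ω ∂P)).add (memLp_regression hxm hx hε)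

theorem memLp_residual (hxm : Measurable x) (hx : MemLp x 2 P) (hε : MemLp ε 2 P) :
    MemLp (residual x ε P) 2 P :=
  hε.sub (memLp_condMean hxm hx hε)

end Regression

section GaussianAffine

variable {Ω E F : Type*} [MeasurableSpace Ω] {P : Measure Ω}
  [NormedAddCommGroup E] [NormedSpace ℝ E] [MeasurableSpace E] [BorelSpace E]
  [NormedAddCommGroup F] [NormedSpace ℝ F] [MeasurableSpace F] [BorelSpace F]

theorem hasGaussianLaw_add_const {Z : Ω → E} (hZ : HasGaussianLaw Z P) (c : E) :
    HasGaussianLaw (fun ω ↦ Z ω + c) P := by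
  have := hZ.isGaussian_map
  have hmap : IsGaussian ((P.map Z).map fun z ↦ z + c) := inferInstance
  rw [AEMeasurable.map_map_of_aemeasurable (by fun_prop) hZ.aemeasurable] at hmap
  exact ⟨hmap⟩

theorem hasGaussianLaw_sub_clm [SecondCountableTopology E] [SecondCountableTopology F] {x : Ω → E}
    {ε : Ω → F} (h : HasGaussianLaw (fun ω ↦ (ε ω, x ω)) P) (G : E →L[ℝ] F) (a : F) (b : E) :
    HasGaussianLaw (fun ω ↦ (ε ω - (a + G (x ω - b)), x ω)) P := by
  let T : F × E →L[ℝ] F × E :=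
    (ContinuousLinearMap.fst ℝ F E - G ∘L ContinuousLinearMap.snd ℝ F E).prod
      (ContinuousLinearMap.snd ℝ F E)
  refine (hasGaussianLaw_add_const (h.map_fun T) (G b - a, 0)).congr (ae_of_all _ fun ω ↦ ?_)
  simp only [T, ContinuousLinearMap.prod_apply, sub_apply, ContinuousLinearMap.coe_fst',
    ContinuousLinearMap.comp_apply, ContinuousLinearMap.coe_snd', Prod.mk_add_mk, add_zero, map_sub]
  congr 1
  abel

end GaussianAffine

section ResidualLaw

variable {Ω X Y : Type*} [MeasurableSpace Ω] {P : Measure Ω} [IsProbabilityMeasure P]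
  [NormedAddCommGroup X] [InnerProductSpace ℝ X] [CompleteSpace X]
  [NormedAddCommGroup Y] [InnerProductSpace ℝ Y] [CompleteSpace Y]
  {x : Ω → X} {ε : Ω → Y}

theorem integral_gain (hx : MemLp x 2 P) (δ : ℝ) :
    ∫ ω, gain x ε P δ (x ω - ∫ ω, x ω ∂P) ∂P = 0 := by
  have hint : Integrable x P := hx.integrable one_le_two
  rw [(gain x ε P δ).integral_comp_comm (φ := fun ω ↦ x ω - ∫ ω, x ω ∂P)
    (hint.sub (integrable_const _)),
    integral_sub hint (integrable_const _), integral_const, probReal_univ, one_smul, sub_self,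
    map_zero]

variable [SecondCountableTopology X] [MeasurableSpace X] [BorelSpace X]
  [SecondCountableTopology Y] [MeasurableSpace Y] [BorelSpace Y]

theorem integral_regression (hxm : Measurable x) (hx : MemLp x 2 P) (hε : MemLp ε 2 P) :
    ∫ ω, regression x ε P (x ω) ∂P = 0 := by
  have h := tendsto_integral_of_tendsto_eLpNorm_two (memLp_gain (ε := ε) hx)
    (memLp_regression hxm hx hε) (tendsto_eLpNorm_gain_sub_regression hxm hx hε)
  simp only [integral_gain hx] at h
  exact tendsto_nhds_unique h tendsto_const_nhds

theorem integral_condMean (hxm : Measurable x) (hx : MemLp x 2 P) (hε : MemLp ε 2 P) :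
    ∫ ω, condMean x ε P (x ω) ∂P = ∫ ω, ε ω ∂P := by
  simp only [condMean]
  rw [integral_add (integrable_const _) ((memLp_regression hxm hx hε).integrable one_le_two),
    integral_regression hxm hx hε, integral_const, probReal_univ, one_smul, add_zero]

theorem integral_residual (hxm : Measurable x) (hx : MemLp x 2 P) (hε : MemLp ε 2 P) :
    ∫ ω, residual x ε P ω ∂P = 0 := by
  simp only [residual]
  rw [integral_sub (hε.integrable one_le_two)
    ((memLp_condMean hxm hx hε).integrable one_le_two), integral_condMean hxm hx hε, sub_self]

theorem centred_residual (hxm : Measurable x) (hx : MemLp x 2 P) (hε : MemLp ε 2 P) :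
    centred (memLp_residual hxm hx hε) = centred hε - (memLp_regression hxm hx hε).toLp _ := by
  refine Lp.ext ?_
  filter_upwards [centred_ae (memLp_residual hxm hx hε),
    Lp.coeFn_sub (centred hε) ((memLp_regression hxm hx hε).toLp _), centred_ae hε,
    MemLp.coeFn_toLp (memLp_regression hxm hx hε)] with ω hres hsub hεω hreg
  rw [hres, hsub, Pi.sub_apply, hεω, hreg, integral_residual hxm hx hε, residual, condMean]
  abel

theorem covOp_residual (hxm : Measurable x) (hx : MemLp x 2 P) (hε : MemLp ε 2 P) :
    covOp (residual x ε P) P = condCov x ε P := by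
  rw [condCov, (tendsto_gain_comp_crossCov hxm hx hε).limUnder_eq, covOp, covOp,
    crossCov_eq_adjoint_comp hε hε,
    crossCov_eq_adjoint_comp (memLp_residual hxm hx hε) (memLp_residual hxm hx hε),
    centred_residual hxm hx hε, map_sub, pairing_regression hxm hx hε]
  set B := pairing P (centred hε)
  set V := (pairing P (centred hx)).range.topologicalClosure
  ext1 v
  refine ext_inner_left ℝ fun w ↦ ?_
  have horth : inner ℝ (V.starProjection (B w)) (B v - V.starProjection (B v)) = 0 :=
    Submodule.inner_right_of_mem_orthogonal (Submodule.starProjection_apply_mem V _)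
      (Submodule.sub_starProjection_mem_orthogonal _)
  simp only [ContinuousLinearMap.comp_apply, sub_apply, inner_sub_right,
    ContinuousLinearMap.adjoint_inner_right, inner_sub_left] at horth ⊢
  linarith

theorem covariance_residual (hxm : Measurable x) (hx : MemLp x 2 P) (hε : MemLp ε 2 P)
    (v : Y) (u : X) :
    cov[fun ω ↦ inner ℝ v (residual x ε P ω), fun ω ↦ inner ℝ u (x ω); P] = 0 := by
  have hres := memLp_residual hxm hx hε
  rw [← inner_crossCov hres hx, inner_crossCov_eq_inner_pairing hres hx,
    centred_residual hxm hx hε, map_sub, pairing_regression hxm hx hε]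
  exact Submodule.inner_left_of_mem_orthogonal
    (Submodule.le_topologicalClosure _ (LinearMap.mem_range_self _ _))
    (Submodule.sub_starProjection_mem_orthogonal _)

theorem hasGaussianLaw_residual (hxm : Measurable x)
    (h : HasGaussianLaw (fun ω ↦ (ε ω, x ω)) P) :
    HasGaussianLaw (fun ω ↦ (residual x ε P ω, x ω)) P := by
  have hx := h.snd.memLp_two
  have hε := h.fst.memLp_two
  refine hasGaussianLaw_of_tendsto_eLpNorm_two (l := 𝓝[>] 0)
    (fun δ ↦ hasGaussianLaw_sub_clm h (gain x ε P δ) (∫ ω, ε ω ∂P) (∫ ω, x ω ∂P))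
    (MemLp.of_fst_snd ⟨memLp_residual hxm hx hε, hx⟩)
    ((tendsto_eLpNorm_gain_sub_regression hxm hx hε).congr fun δ ↦ ?_)
  refine eLpNorm_congr_norm_ae (ae_of_all _ fun ω ↦ ?_)
  simp only [Pi.sub_apply, Prod.mk_sub_mk, sub_self, Prod.norm_mk, norm_zero, norm_nonneg,
    sup_of_le_left, residual, condMean, sub_sub_sub_cancel_left, add_sub_add_left_eq_sub]
  exact norm_sub_rev _ _

end ResidualLaw

section CovarianceOfSums

variable {Ω Y : Type*} [MeasurableSpace Ω] {P : Measure Ω}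
  [NormedAddCommGroup Y] [InnerProductSpace ℝ Y]

theorem covOp_map_id [MeasurableSpace Y] [BorelSpace Y] [SecondCountableTopology Y]
    {U : Ω → Y} (hU : AEMeasurable U P) :
    covOp (id : Y → Y) (P.map U) = covOp U P := by
  have hcont : Continuous fun z : Y ↦ (innerSL ℝ (id z - ∫ z', id z' ∂(P.map U))).smulRight
      (id z - ∫ z', id z' ∂(P.map U)) :=
    ((ContinuousLinearMap.smulRightL ℝ Y Y).continuous₂).comp
      (((innerSL ℝ).continuous.comp (continuous_id.sub continuous_const)).prodMk
        (continuous_id.sub continuous_const))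
  rw [covOp, covOp, crossCov, integral_map hU hcont.aestronglyMeasurable,
    integral_map hU aestronglyMeasurable_id]
  rfl

theorem covariance_inner_eq_zero_of_indepFun {X : Type*} [NormedAddCommGroup X]
    [InnerProductSpace ℝ X] [MeasurableSpace X] [BorelSpace X] [MeasurableSpace Y] [BorelSpace Y]
    {U : Ω → X} {V : Ω → Y}
    (hU : MemLp U 2 P) (hV : MemLp V 2 P) (h : IndepFun U V P) (u : X) (v : Y) :
    cov[fun ω ↦ inner ℝ u (U ω), fun ω ↦ inner ℝ v (V ω); P] = 0 :=
  (h.comp (φ := fun z ↦ inner ℝ u z) (ψ := fun z ↦ inner ℝ v z) (by fun_prop)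
    (by fun_prop)).covariance_eq_zero (hU.const_inner u) (hV.const_inner v)

variable [CompleteSpace Y] [IsProbabilityMeasure P]

theorem covOp_const_add {U : Ω → Y} (hU : Integrable U P) (a : Y) :
    covOp (fun ω ↦ a + U ω) P = covOp U P := by
  have hmean : ∫ ω, a + U ω ∂P = a + ∫ ω, U ω ∂P := by
    rw [integral_add (integrable_const _) hU, integral_const, probReal_univ, one_smul]
  simp only [covOp, crossCov, hmean, add_sub_add_left_eq_sub]

theorem covOp_add_of_indepFun [MeasurableSpace Y] [BorelSpace Y] {U V : Ω → Y}
    (hU : MemLp U 2 P) (hV : MemLp V 2 P) (h : IndepFun U V P) :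
    covOp (fun ω ↦ U ω + V ω) P = covOp U P + covOp V P := by
  ext1 u
  refine ext_inner_left ℝ fun v ↦ ?_
  have hUi : ∀ w : Y, MemLp (fun ω ↦ inner ℝ w (U ω)) 2 P := fun w ↦ hU.const_inner w
  have hVi : ∀ w : Y, MemLp (fun ω ↦ inner ℝ w (V ω)) 2 P := fun w ↦ hV.const_inner w
  have hsum : ∀ w : Y, (fun ω ↦ inner ℝ w (U ω + V ω))
      = (fun ω ↦ inner ℝ w (U ω)) + fun ω ↦ inner ℝ w (V ω) := fun w ↦
    funext fun ω ↦ inner_add_right _ _ _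
  have hUV : MemLp (fun ω ↦ U ω + V ω) 2 P := hU.add hV
  rw [add_apply, inner_add_right, covOp, covOp, covOp, inner_crossCov hUV hUV,
    inner_crossCov hU hU, inner_crossCov hV hV]
  rw [hsum, hsum, covariance_add_left (hUi u) (hVi u) ((hUi v).add (hVi v)),
    covariance_add_right (hUi u) (hUi v) (hVi v), covariance_add_right (hVi u) (hUi v) (hVi v),
    covariance_inner_eq_zero_of_indepFun hU hV h,
    covariance_inner_eq_zero_of_indepFun hV hU h.symm, add_zero, zero_add]

end CovarianceOfSums

section ConditionalLaw

theorem condDistrib_of_indepFun {Ω A B C : Type*} [MeasurableSpace Ω] [MeasurableSpace A]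
    [MeasurableSpace B] [MeasurableSpace C] [StandardBorelSpace C] [Nonempty C] {P : Measure Ω}
    [IsProbabilityMeasure P] {x : Ω → A} {ζ : Ω → B} {f : A × B → C} (hf : Measurable f)
    (hx : Measurable x) (hζ : Measurable ζ) (hindep : IndepFun x ζ P) :
    ∀ᵐ u ∂(P.map x), condDistrib (fun ω ↦ f (x ω, ζ ω)) x P u = P.map fun ω ↦ f (u, ζ ω) := by
  have : IsProbabilityMeasure (P.map ζ) := Measure.isProbabilityMeasure_map hζ.aemeasurable
  let κ : Kernel A C := (Kernel.id ×ₖ Kernel.const A (P.map ζ)).map f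
  have : IsMarkovKernel κ := Kernel.IsMarkovKernel.map _ hf
  have hκ : ∀ u, κ u = P.map fun ω ↦ f (u, ζ ω) := by
    intro u
    rw [Kernel.map_apply _ hf, Kernel.prod_apply, Kernel.id_apply, Kernel.const_apply,
      Measure.dirac_prod, Measure.map_map hf (by fun_prop), Measure.map_map (by fun_prop) hζ]
    rfl
  have hgraph : Measurable fun p : A × B ↦ (p.1, f p) := measurable_fst.prodMk hf
  have hjoint : P.map (fun ω ↦ (x ω, f (x ω, ζ ω))) = P.map x ⊗ₘ κ := by
    have hprod := (indepFun_iff_map_prod_eq_prod_map_map hx.aemeasurable hζ.aemeasurable).1 hindep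
    have hmap : P.map (fun ω ↦ (x ω, f (x ω, ζ ω)))
        = ((P.map x).prod (P.map ζ)).map fun p ↦ (p.1, f p) := by
      rw [← hprod, Measure.map_map hgraph (hx.prodMk hζ)]
      rfl
    ext s hs
    rw [hmap, Measure.map_apply hgraph hs, Measure.prod_apply (hgraph hs),
      Measure.compProd_apply hs]
    refine lintegral_congr fun u ↦ ?_
    rw [hκ, Measure.map_apply (by fun_prop) (measurable_prodMk_left hs),
      Measure.map_apply hζ (measurable_prodMk_left (hgraph hs))]
    rfl
  filter_upwards [condDistrib_ae_eq_of_measure_eq_compProd x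
    (hf.comp (hx.prodMk hζ)).aemeasurable hjoint] with u hu
  exact hu.trans (hκ u)

variable {Ω X Y : Type*} [MeasurableSpace Ω] {P : Measure Ω} [IsProbabilityMeasure P]
  [NormedAddCommGroup X] [InnerProductSpace ℝ X] [CompleteSpace X]
  [SecondCountableTopology X] [MeasurableSpace X] [BorelSpace X]
  [NormedAddCommGroup Y] [InnerProductSpace ℝ Y] [CompleteSpace Y]
  [SecondCountableTopology Y] [MeasurableSpace Y] [BorelSpace Y]
  {x : Ω → X} {ε η : Ω → Y}

theorem isGaussianWith_map_const_add {ζ : Ω → Y} (hζ : HasGaussianLaw ζ P) (a : Y) :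
    IsGaussianWith (P.map fun ω ↦ a + ζ ω) (a + ∫ ω, ζ ω ∂P) (covOp ζ P) := by
  have hint : Integrable ζ P := hζ.integrable
  have hm : AEMeasurable (fun ω ↦ a + ζ ω) P := hζ.aemeasurable.const_add _
  refine ⟨?_, ?_, ?_⟩
  · simpa only [add_comm a] using (hasGaussianLaw_add_const hζ a).isGaussian_map
  · rw [integral_map hm (by fun_prop), integral_add (integrable_const _) hint, integral_const,
      probReal_univ, one_smul]
  · rw [covOp_map_id hm, covOp_const_add hint]

theorem indepFun_residual_prodMk (hx : Measurable x) (hx2 : MemLp x 2 P) (hε2 : MemLp ε 2 P)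
    (hindep : IndepFun η (fun ω ↦ (ε ω, x ω)) P) :
    IndepFun (fun ω ↦ (residual x ε P ω, x ω)) η P := by
  have hm : Measurable (condMean x ε P) := (measurable_regression hx hx2 hε2).const_add _
  exact (hindep.comp (φ := fun z ↦ z) (ψ := fun p : Y × X ↦ (p.1 - condMean x ε P p.2, p.2))
    measurable_id (by fun_prop)).symm

theorem hasGaussianLaw_residual_add (hx : Measurable x)
    (hgauss : HasGaussianLaw (fun ω ↦ (ε ω, x ω)) P) (hη : HasGaussianLaw η P)
    (hindep : IndepFun η (fun ω ↦ (ε ω, x ω)) P) :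
    HasGaussianLaw (fun ω ↦ (x ω, residual x ε P ω + η ω)) P := by
  have hind := indepFun_residual_prodMk hx hgauss.snd.memLp_two hgauss.fst.memLp_two hindep
  exact (IndepFun.hasGaussianLaw (hasGaussianLaw_residual hx hgauss) hη hind).map_fun
    (((ContinuousLinearMap.snd ℝ Y X).comp (ContinuousLinearMap.fst ℝ (Y × X) Y)).prod
      ((ContinuousLinearMap.fst ℝ Y X).comp (ContinuousLinearMap.fst ℝ (Y × X) Y)
        + ContinuousLinearMap.snd ℝ (Y × X) Y))

theorem indepFun_residual_add (hx : Measurable x)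
    (hgauss : HasGaussianLaw (fun ω ↦ (ε ω, x ω)) P) (hη : HasGaussianLaw η P)
    (hindep : IndepFun η (fun ω ↦ (ε ω, x ω)) P) :
    IndepFun x (fun ω ↦ residual x ε P ω + η ω) P := by
  have hx2 := hgauss.snd.memLp_two
  have hε2 := hgauss.fst.memLp_two
  have hres2 := memLp_residual hx hx2 hε2
  have hxη : IndepFun x η P := (indepFun_residual_prodMk hx hx2 hε2 hindep).comp
    (φ := Prod.snd) (ψ := id) measurable_snd measurable_id
  refine (hasGaussianLaw_residual_add hx hgauss hη hindep).indepFun_of_covariance_inner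
    fun u v ↦ ?_
  have hsum : (fun ω ↦ inner ℝ v (residual x ε P ω + η ω))
      = (fun ω ↦ inner ℝ v (residual x ε P ω)) + fun ω ↦ inner ℝ v (η ω) :=
    funext fun ω ↦ inner_add_right _ _ _
  rw [hsum, covariance_add_right (hx2.const_inner u) (hres2.const_inner v)
    (hη.memLp_two.const_inner v), covariance_comm, covariance_residual hx hx2 hε2, zero_add,
    covariance_inner_eq_zero_of_indepFun hx2 hη.memLp_two hxη]

theorem covOp_residual_add (hx : Measurable x) (hx2 : MemLp x 2 P) (hε2 : MemLp ε 2 P)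
    (hη2 : MemLp η 2 P) (hindep : IndepFun η (fun ω ↦ (ε ω, x ω)) P) :
    covOp (fun ω ↦ residual x ε P ω + η ω) P = condNoiseCov x ε η P := by
  have hresη : IndepFun (residual x ε P) η P := (indepFun_residual_prodMk hx hx2 hε2 hindep).comp
    (φ := Prod.fst) (ψ := id) measurable_fst measurable_id
  rw [covOp_add_of_indepFun (memLp_residual hx hx2 hε2) hη2 hresη, covOp_residual hx hx2 hε2,
    condNoiseCov, add_comm]

theorem isGaussianWith_condDistrib {y : Ω → Y} {G : X → Y}
    (hx : Measurable x) (hε : Measurable ε) (hη : Measurable η) (hG : Measurable G)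
    (hy : ∀ ω, y ω = G (x ω) + ε ω + η ω)
    (hgauss : HasGaussianLaw (fun ω ↦ (ε ω, x ω)) P)
    (hηgauss : HasGaussianLaw η P) (hη0 : ∫ ω, η ω ∂P = 0)
    (hindep : IndepFun η (fun ω ↦ (ε ω, x ω)) P) :
    ∀ᵐ u ∂(P.map x), IsGaussianWith (condDistrib y x P u) (G u + condMean x ε P u)
      (condNoiseCov x ε η P) := by
  have hx2 := hgauss.snd.memLp_two
  have hε2 := hgauss.fst.memLp_two
  have hm : Measurable (condMean x ε P) := (measurable_regression hx hx2 hε2).const_add _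
  have hy' : y = fun ω ↦ G (x ω) + condMean x ε P (x ω) + (residual x ε P ω + η ω) := by
    ext1 ω
    rw [hy, residual]
    abel
  have hmean : ∫ ω, residual x ε P ω + η ω ∂P = 0 := by
    rw [integral_add ((memLp_residual hx hx2 hε2).integrable one_le_two) hηgauss.integrable,
      integral_residual hx hx2 hε2, hη0, add_zero]
  filter_upwards [condDistrib_of_indepFun
    (f := fun p : X × Y ↦ G p.1 + condMean x ε P p.1 + p.2) (by fun_prop) hx
    ((measurable_residual hx hε hx2 hε2).add hη)
    (indepFun_residual_add hx hgauss hηgauss hindep)] with u hu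
  have hlaw := isGaussianWith_map_const_add
    (hasGaussianLaw_residual_add hx hgauss hηgauss hindep).snd (G u + condMean x ε P u)
  rw [hmean, add_zero, covOp_residual_add hx hx2 hε2 hηgauss.memLp_two hindep] at hlaw
  rw [hy']
  exact hu ▸ hlaw

end ConditionalLaw

section LebesgueDecomposition

variable {Y A B : Type*} [MeasurableSpace Y] [MeasurableSpace A] [MeasurableSpace B]
  {μ ν : Measure Y} {S T : Set Y}

/-- `S` carries the part of `μ` that is singular with respect to `ν`. -/
structure IsSingularSet (μ ν : Measure Y) (S : Set Y) : Prop where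
  measurableSet : MeasurableSet S
  null : ν S = 0
  absolutelyContinuous : μ.restrict Sᶜ ≪ ν

theorem exists_isSingularSet (μ ν : Measure Y) [μ.HaveLebesgueDecomposition ν] :
    ∃ S, IsSingularSet μ ν S := by
  obtain ⟨T, hT, hsing, hnull⟩ := Measure.mutuallySingular_singularPart μ ν
  refine ⟨Tᶜ, hT.compl, hnull, ?_⟩
  rw [compl_compl]
  refine Measure.AbsolutelyContinuous.mk fun N hN hN0 ↦ ?_
  rw [Measure.restrict_apply hN, ← Measure.singularPart_add_rnDeriv μ ν, Measure.add_apply,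
    measure_mono_null Set.inter_subset_right hsing, zero_add]
  exact withDensity_absolutelyContinuous _ _ (measure_mono_null Set.inter_subset_left hN0)

theorem IsSingularSet.measure_diff_eq_zero (hS : IsSingularSet μ ν S)
    (hT : IsSingularSet μ ν T) : μ (S \ T) = 0 := by
  have h := hT.absolutelyContinuous hS.null
  rwa [Measure.restrict_apply hS.measurableSet] at h

theorem IsSingularSet.ae_eq (hS : IsSingularSet μ ν S) (hT : IsSingularSet μ ν T) :
    S =ᵐ[μ] T :=
  ae_eq_set.2 ⟨hS.measure_diff_eq_zero hT, hT.measure_diff_eq_zero hS⟩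

theorem IsSingularSet.absolutelyContinuous_of_measure_eq_zero (hS : IsSingularSet μ ν S)
    (h : μ S = 0) : μ ≪ ν := by
  rw [← Measure.restrict_eq_self_of_ae_mem (s := Sᶜ) (measure_eq_zero_iff_ae_notMem.1 h)]
  exact hS.absolutelyContinuous

/-- Since `z = a (ξ z, q z)`, both measures are images of products, and no singular part comes
from the first factor. -/
theorem IsSingularSet.exists_ae_eq_preimage [IsFiniteMeasure μ] [IsFiniteMeasure ν]
    {ξ : Y → A} {q : Y → B} {a : A × B → Y} (hξ : Measurable ξ) (hq : Measurable q)
    (ha : Measurable a) (haq : ∀ z, a (ξ z, q z) = z) (hμ : IndepFun ξ q μ)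
    (hν : IndepFun ξ q ν) (hac : μ.map ξ ≪ ν.map ξ) (hS : IsSingularSet μ ν S) :
    ∃ T : Set B, MeasurableSet T ∧ S =ᵐ[μ] q ⁻¹' T := by
  obtain ⟨T, hT⟩ := exists_isSingularSet (μ.map q) (ν.map q)
  refine ⟨T, hT.measurableSet, hS.ae_eq ⟨hq hT.measurableSet, ?_, ?_⟩⟩
  · rw [← Measure.map_apply hq hT.measurableSet, hT.null]
  · refine Measure.AbsolutelyContinuous.mk fun N hN hN0 ↦ ?_
    rw [indepFun_iff_map_prod_eq_prod_map_map hξ.aemeasurable hq.aemeasurable] at hμ hν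
    have hνN : ((ν.map ξ).prod (ν.map q)) (a ⁻¹' N) = 0 := by
      rw [← hν, Measure.map_apply (hξ.prodMk hq) (ha hN)]
      simpa only [Set.preimage_preimage, haq, Set.preimage_id'] using hN0
    have hμN : ((μ.map ξ).prod ((μ.map q).restrict Tᶜ)) (a ⁻¹' N) = 0 :=
      hac.prod hT.absolutelyContinuous hνN
    rw [← (μ.map ξ).restrict_univ, Measure.prod_restrict, ← hμ,
      Measure.restrict_apply (ha hN), Measure.map_apply (hξ.prodMk hq)
        ((ha hN).inter (MeasurableSet.univ.prod hT.measurableSet.compl))] at hμN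
    rw [Measure.restrict_apply hN]
    convert hμN using 2
    ext z
    simp [haq]

theorem setIntegral_preimage_mul_of_indepFun {ξ : Y → A} {q : Y → B} (hξ : Measurable ξ)
    (hq : Measurable q) (h : IndepFun ξ q μ) {T : Set B} (hT : MeasurableSet T) {f : A → ℂ}
    {g : B → ℂ} (hf : Measurable f) (hg : Measurable g) :
    ∫ z in q ⁻¹' T, f (ξ z) * g (q z) ∂μ
      = (∫ z, f (ξ z) ∂μ) * ∫ z in q ⁻¹' T, g (q z) ∂μ := by
  rw [← integral_indicator (hq hT), ← integral_indicator (hq hT)]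
  simp only [Set.indicator_mul_right]
  exact h.integral_fun_comp_mul_comp (g := T.indicator g) hξ.aemeasurable hq.aemeasurable
    hf.aestronglyMeasurable (hg.indicator hT).aestronglyMeasurable

theorem measure_eq_zero_or_one_of_restrict_eq_smul [IsProbabilityMeasure μ]
    (hS : MeasurableSet S) (h : μ.restrict S = μ S • μ) : μ S = 0 ∨ μ S = 1 := by
  refine measure_eq_zero_or_one_of_indepSet_self ((indepSet_iff_measure_inter_eq_mul hS hS μ).2 ?_)
  rw [← Measure.restrict_apply hS, h, Measure.smul_apply, smul_eq_mul]

end LebesgueDecomposition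

section GaussianDichotomy

theorem absolutelyContinuous_of_absolutelyContinuous_real {μ ν : Measure ℝ} [hμ : IsGaussian μ]
    [hν : IsGaussian ν] (h : ν ≪ μ) : μ ≪ ν := by
  rw [IsGaussian.eq_gaussianReal μ hμ] at h ⊢
  by_cases hvμ : (Var[id; μ]).toNNReal = 0
  · rw [hvμ, gaussianReal_zero_var] at h ⊢
    have hatom : ν {μ[id]} = 1 := by
      rw [← prob_compl_eq_zero_iff (measurableSet_singleton _)]
      exact h (by simp)
    refine Measure.AbsolutelyContinuous.mk fun N hN hN0 ↦ ?_
    by_contra hmem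
    rw [Measure.dirac_apply' _ hN, Set.indicator_apply_eq_zero, Classical.not_imp] at hmem
    have hnull := measure_mono_null (Set.singleton_subset_iff.2 hmem.1) hN0
    exact one_ne_zero (hatom.symm.trans hnull)
  · have hνvol : ν ≪ volume := h.trans (gaussianReal_absolutelyContinuous _ hvμ)
    rw [IsGaussian.eq_gaussianReal ν hν] at hνvol ⊢
    have hvν : (Var[id; ν]).toNNReal ≠ 0 := fun h0 ↦ by
      rw [h0, gaussianReal_zero_var] at hνvol
      exact absurd (hνvol (measure_singleton (ν[id]))) (by simp)
    exact (gaussianReal_absolutelyContinuous _ hvμ).trans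
      (gaussianReal_absolutelyContinuous' _ hvν)

variable {Y ι : Type*} [NormedAddCommGroup Y] [InnerProductSpace ℝ Y]

/-- Removal of the component along the unit vector `v`: the projection onto its orthogonal
complement, as an operator of the whole space. -/
noncomputable def removeCoord (v : Y) : Y →L[ℝ] Y :=
  ContinuousLinearMap.id ℝ Y - (innerSL ℝ v).smulRight v

theorem removeCoord_apply (v z : Y) : removeCoord v z = z - inner ℝ v z • v := rfl

theorem inner_removeCoord (v w z : Y) :
    inner ℝ w (removeCoord v z) = inner ℝ (removeCoord v w) z := by
  simp only [removeCoord_apply, inner_sub_left, inner_sub_right, real_inner_smul_left,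
    real_inner_smul_right, real_inner_comm w v, mul_comm]

variable [CompleteSpace Y] [SecondCountableTopology Y] [MeasurableSpace Y] [BorelSpace Y]
  {e : HilbertBasis ι ℝ Y} {μ ν : Measure Y} {r lam : ι → ℝ} {v : Y} {s : ℝ} {S : Set Y}

theorem covariance_inner_eq_inner_covOp [IsGaussian μ] (u v : Y) :
    cov[fun z ↦ inner ℝ u z, fun z ↦ inner ℝ v z; μ] = inner ℝ v (covOp (id : Y → Y) μ u) :=
  (inner_crossCov IsGaussian.memLp_two_id IsGaussian.memLp_two_id u v).symm

theorem indepFun_inner_removeCoord [IsGaussian μ] (hv : ‖v‖ = 1)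
    (hμ : covOp (id : Y → Y) μ v = s • v) :
    IndepFun (fun z ↦ inner ℝ v z) (removeCoord v) μ := by
  have hG : HasGaussianLaw (fun z : Y ↦ ((inner ℝ v z : ℝ), removeCoord v z)) μ :=
    (IsGaussian.hasGaussianLaw_id (μ := μ)).map_fun ((innerSL ℝ v).prod (removeCoord v))
  refine hG.indepFun_of_covariance_inner fun c w ↦ ?_
  simp only [inner_removeCoord, RCLike.inner_apply, conj_trivial, mul_comm _ c]
  rw [covariance_const_mul_left, covariance_inner_eq_inner_covOp, hμ, real_inner_smul_right,
    removeCoord_apply, inner_sub_left, real_inner_smul_left, real_inner_self_eq_norm_sq, hv,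
    real_inner_comm]
  ring

theorem exists_ae_eq_preimage_removeCoord [IsGaussian μ] [IsGaussian ν] {s' : ℝ} (hv : ‖v‖ = 1)
    (hμ : covOp (id : Y → Y) μ v = s • v) (hν : covOp (id : Y → Y) ν v = s' • v) (h : ν ≪ μ)
    (hS : IsSingularSet μ ν S) : ∃ T, MeasurableSet T ∧ S =ᵐ[μ] removeCoord v ⁻¹' T := by
  have hcoord : Measurable fun z : Y ↦ (inner ℝ v z : ℝ) := by fun_prop
  have hμcoord : IsGaussian (μ.map fun z ↦ inner ℝ v z) := isGaussian_map (innerSL ℝ v)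
  have hνcoord : IsGaussian (ν.map fun z ↦ inner ℝ v z) := isGaussian_map (innerSL ℝ v)
  exact hS.exists_ae_eq_preimage (a := fun p ↦ p.1 • v + p.2) hcoord (removeCoord v).measurable
    (by fun_prop) (fun z ↦ by rw [removeCoord_apply, add_sub_cancel])
    (indepFun_inner_removeCoord hv hμ) (indepFun_inner_removeCoord hv hν)
    (absolutelyContinuous_of_absolutelyContinuous_real (h.map hcoord))

theorem charFun_restrict_add_smul [IsGaussian μ] (hv : ‖v‖ = 1)
    (hμ : covOp (id : Y → Y) μ v = s • v) {T : Set Y} (hT : MeasurableSet T)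
    (hST : S =ᵐ[μ] removeCoord v ⁻¹' T) {t : Y} (ht : inner ℝ v t = 0) (c : ℝ) :
    charFun (μ.restrict S) (t + c • v)
      = charFun (μ.map fun z ↦ inner ℝ v z) c * charFun (μ.restrict S) t := by
  have hcoord : Measurable fun z : Y ↦ (inner ℝ v z : ℝ) := by fun_prop
  have hinner (z : Y) : (inner ℝ (removeCoord v z) t : ℝ) = inner ℝ z t := by
    rw [removeCoord_apply, inner_sub_left, real_inner_smul_left, ht, mul_zero, sub_zero]
  have hsplit := setIntegral_preimage_mul_of_indepFun hcoord (removeCoord v).measurable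
    (indepFun_inner_removeCoord hv hμ) hT (f := fun a ↦ Complex.exp (inner ℝ a c * Complex.I))
    (g := fun b ↦ Complex.exp (inner ℝ b t * Complex.I)) (by fun_prop) (by fun_prop)
  simp only [hinner, ← Complex.exp_add, ← add_mul, ← Complex.ofReal_add] at hsplit
  rw [Measure.restrict_congr_set hST, charFun_apply, charFun_apply, charFun_apply,
    integral_map hcoord.aemeasurable (by fun_prop), ← hsplit]
  congr with z
  rw [inner_add_right, real_inner_smul_right, real_inner_comm v z, add_comm,
    RCLike.inner_apply, conj_trivial]

theorem charFun_restrict_sum_smul [IsGaussian μ]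
    (hμ : ∀ k, covOp (id : Y → Y) μ (e k) = r k • e k)
    (hS : ∀ k, ∃ T, MeasurableSet T ∧ S =ᵐ[μ] removeCoord (e k) ⁻¹' T) (c : ι → ℝ)
    (s : Finset ι) : charFun (μ.restrict S) (∑ k ∈ s, c k • e k)
      = μ.real S * charFun μ (∑ k ∈ s, c k • e k) := by
  classical
  induction s using Finset.induction_on with
  | empty => simp
  | insert j s hj ih =>
    have hperp : inner ℝ (e j) (∑ k ∈ s, c k • e k) = 0 := by
      rw [inner_sum]
      refine Finset.sum_eq_zero fun k hk ↦ ?_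
      rw [real_inner_smul_right, e.orthonormal.2 (ne_of_mem_of_not_mem hk hj).symm, mul_zero]
    obtain ⟨T, hT, hST⟩ := hS j
    have hrestrict := charFun_restrict_add_smul (e.orthonormal.1 j) (hμ j) hT hST hperp (c j)
    have hfull := charFun_restrict_add_smul (e.orthonormal.1 j) (hμ j) (S := Set.univ)
      MeasurableSet.univ (by rw [Set.preimage_univ]; exact EventuallyEq.rfl) hperp (c j)
    rw [Measure.restrict_univ] at hfull
    rw [Finset.sum_insert hj, add_comm, hrestrict, hfull, ih, mul_left_comm]

theorem restrict_eq_smul_of_ae_eq_preimage_removeCoord [IsGaussian μ]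
    (hμ : ∀ k, covOp (id : Y → Y) μ (e k) = r k • e k)
    (hS : ∀ k, ∃ T, MeasurableSet T ∧ S =ᵐ[μ] removeCoord (e k) ⁻¹' T) :
    μ.restrict S = μ S • μ := by
  have : IsFiniteMeasure (μ S • μ) := μ.smul_finite (measure_ne_top μ S)
  refine Measure.ext_of_charFun (funext fun t ↦ ?_)
  have hsmul : charFun (μ S • μ) t = μ.real S * charFun μ t := by
    rw [charFun_apply, charFun_apply, integral_smul_measure]
    rfl
  have ht : Tendsto (fun s : Finset ι ↦ ∑ k ∈ s, (e.repr t k : ℝ) • e k) atTop (𝓝 t) :=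
    e.hasSum_repr t
  have hlim := (((continuous_charFun (μ := μ)).tendsto t).comp ht).const_mul (μ.real S : ℂ)
  rw [hsmul]
  exact tendsto_nhds_unique (((continuous_charFun (μ := μ.restrict S)).tendsto t).comp ht)
    (hlim.congr fun s ↦ (charFun_restrict_sum_smul hμ hS _ s).symm)

/-- Half of the Feldman–Hájek dichotomy: the set that carries the singular part of `μ` does not
depend on any single coordinate, so it has probability `0` or `1`, and `ν ≪ μ` excludes `1`. -/
theorem absolutelyContinuous_of_absolutelyContinuous_gaussian [IsGaussian μ] [IsGaussian ν]
    (hμ : ∀ k, covOp (id : Y → Y) μ (e k) = r k • e k)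
    (hν : ∀ k, covOp (id : Y → Y) ν (e k) = lam k • e k) (h : ν ≪ μ) : μ ≪ ν := by
  obtain ⟨S, hS⟩ := exists_isSingularSet μ ν
  have hrestrict := restrict_eq_smul_of_ae_eq_preimage_removeCoord hμ fun k ↦
    exists_ae_eq_preimage_removeCoord (e.orthonormal.1 k) (hμ k) (hν k) h hS
  rcases measure_eq_zero_or_one_of_restrict_eq_smul hS.measurableSet hrestrict with h0 | h1
  · exact hS.absolutelyContinuous_of_measure_eq_zero h0
  · have hcompl : ν Sᶜ = 0 := h ((prob_compl_eq_zero_iff hS.measurableSet).2 h1)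
    rw [prob_compl_eq_zero_iff hS.measurableSet, hS.null] at hcompl
    exact absurd hcompl zero_ne_one

end GaussianDichotomy

section BayesFormula

variable {X Y : Type*} [MeasurableSpace X] {Φ Ψ : X → Y → ℝ} {μ₀ : Measure X} {y : Y}

theorem evidence_congr_ae (h : ∀ᵐ u ∂μ₀, Φ u y = Ψ u y) : evidence Φ μ₀ y = evidence Ψ μ₀ y :=
  lintegral_congr_ae (h.mono fun u hu ↦ by simp only [hu])

theorem evidence_pos [NeZero μ₀] (hΦ : AEMeasurable (fun u ↦ Φ u y) μ₀) :
    0 < evidence Φ μ₀ y := by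
  have hm : AEMeasurable (fun u ↦ ENNReal.ofReal (Real.exp (-Φ u y))) μ₀ := by fun_prop
  rw [pos_iff_ne_zero, evidence, Ne, lintegral_eq_zero_iff' hm]
  intro hzero
  obtain ⟨u, hu⟩ := hzero.exists
  exact (ENNReal.ofReal_pos.2 (Real.exp_pos _)).ne' hu

variable [MeasurableSpace Y] {Q₀ : Measure Y} {d : Y → ℝ≥0∞}

theorem ae_ae_swap_of_ae_prod [SFinite μ₀] [SFinite Q₀] {p : X → Y → Prop}
    (h : ∀ᵐ z ∂(μ₀.prod Q₀), p z.1 z.2) : ∀ᵐ y ∂Q₀, ∀ᵐ u ∂μ₀, p u y := by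
  rw [← Measure.prod_swap] at h
  exact Measure.ae_ae_of_ae_prod (ae_of_ae_map measurable_swap.aemeasurable h)

/-- The likelihood `exp (-Φ)` with values in `[0, ∞]`. -/
noncomputable def likelihood (Φ : X → Y → ℝ) (u : X) (y : Y) : ℝ≥0∞ :=
  ENNReal.ofReal (Real.exp (-Φ u y))

theorem measurable_likelihood (hΦ : Measurable (Function.uncurry Φ)) :
    Measurable (Function.uncurry (likelihood Φ)) :=
  (Real.measurable_exp.comp hΦ.neg).ennreal_ofReal

theorem measurable_likelihood_left (hΦ : Measurable (Function.uncurry Φ)) (y : Y) :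
    Measurable fun u ↦ likelihood Φ u y :=
  (measurable_likelihood hΦ).comp measurable_prodMk_right

theorem measurable_evidence [SFinite μ₀] (hΦ : Measurable (Function.uncurry Φ)) :
    Measurable (evidence Φ μ₀) :=
  (measurable_likelihood hΦ).lintegral_prod_left'

theorem measurableSet_evidence_lt_top [SFinite μ₀] (hΦ : Measurable (Function.uncurry Φ)) :
    MeasurableSet {y | evidence Φ μ₀ y < ∞} :=
  measurableSet_lt (measurable_evidence hΦ) measurable_const

/-- The posterior density `exp (-Φ) / Z`. -/
noncomputable def bayesDensity (Φ : X → Y → ℝ) (μ₀ : Measure X) (y : Y) (u : X) : ℝ≥0∞ :=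
  likelihood Φ u y / evidence Φ μ₀ y

theorem measurable_bayesDensity [SFinite μ₀] (hΦ : Measurable (Function.uncurry Φ)) :
    Measurable (Function.uncurry (bayesDensity Φ μ₀)) :=
  ((measurable_likelihood hΦ).comp measurable_swap).div
    ((measurable_evidence hΦ).comp measurable_fst)

theorem setLIntegral_bayesDensity (hΦ : Measurable (Function.uncurry Φ)) (y : Y) (t : Set X) :
    ∫⁻ u in t, bayesDensity Φ μ₀ y u ∂μ₀
      = (evidence Φ μ₀ y)⁻¹ * ∫⁻ u in t, likelihood Φ u y ∂μ₀ := by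
  simp only [bayesDensity, ENNReal.div_eq_inv_mul]
  exact lintegral_const_mul _ (measurable_likelihood_left hΦ y)

open Classical in
/-- The posterior `y ↦ Z(y)⁻¹ exp (-Φ(·; y)) μ₀`, extended by the prior where `Z(y) = ∞`. -/
noncomputable def bayesKernel (μ₀ : Measure X) [SFinite μ₀]
    (hΦ : Measurable (Function.uncurry Φ)) : Kernel Y X :=
  Kernel.piecewise (measurableSet_evidence_lt_top (μ₀ := μ₀) hΦ)
    (Kernel.withDensity (Kernel.const Y μ₀) (bayesDensity Φ μ₀)) (Kernel.const Y μ₀)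

theorem bayesKernel_apply [SFinite μ₀] (hΦ : Measurable (Function.uncurry Φ))
    (hy : evidence Φ μ₀ y < ∞) :
    bayesKernel μ₀ hΦ y = μ₀.withDensity (bayesDensity Φ μ₀ y) := by
  have hmem : y ∈ {y | evidence Φ μ₀ y < ∞} := hy
  rw [bayesKernel, Kernel.piecewise_apply, if_pos hmem,
    Kernel.withDensity_apply _ (measurable_bayesDensity hΦ), Kernel.const_apply]

theorem bayesKernel_apply_of_evidence_eq_top [SFinite μ₀] (hΦ : Measurable (Function.uncurry Φ))
    (hy : evidence Φ μ₀ y = ∞) : bayesKernel μ₀ hΦ y = μ₀ := by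
  have hmem : y ∉ {y | evidence Φ μ₀ y < ∞} := not_lt_top_iff.2 hy
  rw [bayesKernel, Kernel.piecewise_apply, if_neg hmem, Kernel.const_apply]

theorem evidence_pos_of_measurable [NeZero μ₀] (hΦ : Measurable (Function.uncurry Φ)) (y : Y) :
    0 < evidence Φ μ₀ y :=
  evidence_pos (hΦ.comp measurable_prodMk_right).aemeasurable

instance isMarkovKernel_bayesKernel [IsProbabilityMeasure μ₀]
    (hΦ : Measurable (Function.uncurry Φ)) : IsMarkovKernel (bayesKernel μ₀ hΦ) := by
  refine ⟨fun y ↦ ?_⟩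
  by_cases hy : evidence Φ μ₀ y < ∞
  · refine ⟨?_⟩
    rw [bayesKernel_apply hΦ hy, withDensity_apply _ MeasurableSet.univ,
      setLIntegral_bayesDensity hΦ, Measure.restrict_univ]
    exact ENNReal.inv_mul_cancel (evidence_pos_of_measurable hΦ y).ne' hy.ne
  · rw [bayesKernel_apply_of_evidence_eq_top hΦ (not_lt_top_iff.1 hy)]
    infer_instance

theorem hasBayesDensity_bayesKernel [SigmaFinite μ₀] (hΨ : Measurable (Function.uncurry Ψ))
    (hy : evidence Ψ μ₀ y < ∞) (hΦΨ : ∀ᵐ u ∂μ₀, Φ u y = Ψ u y) :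
    HasBayesDensity (bayesKernel μ₀ hΨ y) Φ μ₀ y := by
  rw [HasBayesDensity, bayesKernel_apply hΨ hy]
  refine ⟨withDensity_absolutelyContinuous _ _, ?_⟩
  have hm : Measurable (bayesDensity Ψ μ₀ y) :=
    (measurable_bayesDensity hΨ).comp measurable_prodMk_left
  filter_upwards [Measure.rnDeriv_withDensity μ₀ hm, hΦΨ] with u hderiv hu
  rw [hderiv, bayesDensity, likelihood, hu, evidence_congr_ae hΦΨ]

/-- The law of unknown and data for the prior `μ₀` when, given the unknown `u`, the data have the
density `y ↦ exp (-Φ(u; y)) d(y)` with respect to `Q₀`. -/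
noncomputable def bayesJoint (Φ : X → Y → ℝ) (μ₀ : Measure X) (Q₀ : Measure Y) (d : Y → ℝ≥0∞) :
    Measure (X × Y) :=
  (μ₀.prod Q₀).withDensity fun p ↦ likelihood Φ p.1 p.2 * d p.2

theorem bayesJoint_prod [SFinite μ₀] [SFinite Q₀] (hΦ : Measurable (Function.uncurry Φ))
    (hd : Measurable d) {t : Set X} {s : Set Y} (ht : MeasurableSet t) (hs : MeasurableSet s) :
    bayesJoint Φ μ₀ Q₀ d (t ×ˢ s)
      = ∫⁻ y in s, (∫⁻ u in t, likelihood Φ u y ∂μ₀) * d y ∂Q₀ := by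
  have hdens : Measurable fun p : X × Y ↦ likelihood Φ p.1 p.2 * d p.2 :=
    (measurable_likelihood hΦ).mul (hd.comp measurable_snd)
  rw [bayesJoint, withDensity_apply _ (ht.prod hs), ← Measure.prod_restrict,
    lintegral_prod_symm' _ hdens]
  exact lintegral_congr fun y ↦ lintegral_mul_const (d y) (measurable_likelihood_left hΦ y)

theorem snd_bayesJoint [SFinite μ₀] [SFinite Q₀] (hΦ : Measurable (Function.uncurry Φ))
    (hd : Measurable d) :
    (bayesJoint Φ μ₀ Q₀ d).snd = Q₀.withDensity fun y ↦ evidence Φ μ₀ y * d y := by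
  ext s hs
  rw [Measure.snd_apply hs, withDensity_apply _ hs, ← Set.univ_prod,
    bayesJoint_prod hΦ hd MeasurableSet.univ hs, Measure.restrict_univ]
  rfl

theorem ae_evidence_lt_top [SFinite μ₀] [SFinite Q₀] (hΦ : Measurable (Function.uncurry Φ))
    (hd : Measurable d) (hd0 : ∀ y, d y ≠ 0) [IsFiniteMeasure (bayesJoint Φ μ₀ Q₀ d)] :
    ∀ᵐ y ∂Q₀, evidence Φ μ₀ y < ∞ := by
  have hfin : ∫⁻ y, evidence Φ μ₀ y * d y ∂Q₀ ≠ ∞ := by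
    rw [← setLIntegral_univ, ← withDensity_apply _ MeasurableSet.univ, ← snd_bayesJoint hΦ hd]
    exact measure_ne_top _ _
  filter_upwards [ae_lt_top ((measurable_evidence hΦ).mul hd) hfin] with y hy
  exact lt_top_iff_ne_top.2 fun htop ↦ by simp [htop, ENNReal.top_mul (hd0 y)] at hy

theorem map_swap_bayesJoint [IsProbabilityMeasure μ₀] [SFinite Q₀]
    (hΦ : Measurable (Function.uncurry Φ)) (hd : Measurable d) (hd0 : ∀ y, d y ≠ 0)
    [IsFiniteMeasure (bayesJoint Φ μ₀ Q₀ d)] :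
    (bayesJoint Φ μ₀ Q₀ d).map Prod.swap
      = (bayesJoint Φ μ₀ Q₀ d).snd ⊗ₘ bayesKernel μ₀ hΦ := by
  have hZd : Measurable fun y ↦ evidence Φ μ₀ y * d y := (measurable_evidence hΦ).mul hd
  refine Measure.ext_prod fun {s t} hs ht ↦ ?_
  rw [Measure.map_apply measurable_swap (hs.prod ht), Set.preimage_swap_prod,
    bayesJoint_prod hΦ hd ht hs, Measure.compProd_apply_prod hs ht, snd_bayesJoint hΦ hd,
    setLIntegral_withDensity_eq_setLIntegral_mul _ hZd (Kernel.measurable_coe _ ht) hs]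
  refine lintegral_congr_ae (ae_restrict_of_ae ?_)
  filter_upwards [ae_evidence_lt_top (μ₀ := μ₀) (Q₀ := Q₀) hΦ hd hd0] with y hy
  rw [Pi.mul_apply, bayesKernel_apply hΦ hy, withDensity_apply _ ht,
    setLIntegral_bayesDensity hΦ, mul_right_comm, ← mul_assoc,
    ENNReal.mul_inv_cancel (evidence_pos_of_measurable hΦ y).ne' hy.ne, one_mul]

theorem compProd_eq_withDensity_prod [SFinite μ₀] [SigmaFinite Q₀] {κ : Kernel X Y}
    [IsSFiniteKernel κ] {f : X → Y → ℝ≥0∞} (hf : Measurable (Function.uncurry f))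
    (hac : ∀ᵐ u ∂μ₀, κ u ≪ Q₀) (hκ : ∀ᵐ u ∂μ₀, (κ u).rnDeriv Q₀ =ᵐ[Q₀] f u) :
    μ₀ ⊗ₘ κ = (μ₀.prod Q₀).withDensity (Function.uncurry f) := by
  ext s hs
  rw [Measure.compProd_apply hs, withDensity_apply _ hs, ← lintegral_indicator hs,
    lintegral_prod _ (hf.indicator hs).aemeasurable]
  refine lintegral_congr_ae ?_
  filter_upwards [hac, hκ] with u hu hderiv
  rw [← Measure.withDensity_rnDeriv_eq _ _ hu, withDensity_congr_ae hderiv,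
    withDensity_apply _ (measurable_prodMk_left hs),
    ← lintegral_indicator (measurable_prodMk_left hs)]
  rfl

theorem exists_compProd_eq_bayesJoint [SFinite μ₀] [SigmaFinite Q₀] {κ : Kernel X Y}
    [IsSFiniteKernel κ] {c : Y → ℝ} (hΨ : Measurable (Function.uncurry Ψ))
    (hΦΨ : ∀ᵐ u ∂μ₀, ∀ᵐ y ∂Q₀, Φ u y = Ψ u y) (hc : AEMeasurable c Q₀)
    (hcpos : ∀ᵐ y ∂Q₀, 0 < c y) (hac : ∀ᵐ u ∂μ₀, κ u ≪ Q₀)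
    (hκ : ∀ᵐ u ∂μ₀, (κ u).rnDeriv Q₀
      =ᵐ[Q₀] fun y ↦ ENNReal.ofReal (Real.exp (-Φ u y) / c y)) :
    ∃ d : Y → ℝ≥0∞, Measurable d ∧ (∀ y, d y ≠ 0) ∧ μ₀ ⊗ₘ κ = bayesJoint Ψ μ₀ Q₀ d := by
  have hd : Measurable fun y ↦ (ENNReal.ofReal (hc.mk c y))⁻¹ :=
    hc.measurable_mk.ennreal_ofReal.inv
  refine ⟨_, hd, fun y ↦ ENNReal.inv_ne_zero.2 ENNReal.ofReal_ne_top,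
    compProd_eq_withDensity_prod
      (f := fun u y ↦ likelihood Ψ u y * (ENNReal.ofReal (hc.mk c y))⁻¹)
      ((measurable_likelihood hΨ).mul (hd.comp measurable_snd)) hac ?_⟩
  filter_upwards [hκ, hΦΨ] with u hu hΨu
  filter_upwards [hu, hΨu, hc.ae_eq_mk, hcpos] with y hderiv hΨy hcy hcy0
  rw [hderiv, ENNReal.ofReal_div_of_pos hcy0, hΨy, hcy, div_eq_mul_inv, likelihood]

end BayesFormula

section Posterior

variable {Ω X Y : Type*} [MeasurableSpace Ω] [MeasurableSpace X] [MeasurableSpace Y]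
  {P : Measure Ω} [IsProbabilityMeasure P] {x : Ω → X} {y : Ω → Y} {Q₀ : Measure Y} [SFinite Q₀]
  {Φ Ψ : X → Y → ℝ} {d : Y → ℝ≥0∞}

theorem hasCondDistrib_bayesKernel [IsProbabilityMeasure (P.map x)] (hx : Measurable x)
    (hy : Measurable y) (hΦ : Measurable (Function.uncurry Φ)) (hd : Measurable d)
    (hd0 : ∀ z, d z ≠ 0) (hJ : P.map (fun ω ↦ (x ω, y ω)) = bayesJoint Φ (P.map x) Q₀ d) :
    HasCondDistrib x y (bayesKernel (P.map x) hΦ) P := by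
  have : IsFiniteMeasure (bayesJoint Φ (P.map x) Q₀ d) := hJ ▸ inferInstance
  have hswap := map_swap_bayesJoint hΦ hd hd0 (μ₀ := P.map x) (Q₀ := Q₀)
  rw [← hJ, Measure.snd_map_prodMk hx, Measure.map_map measurable_swap (hx.prodMk hy)] at hswap
  exact ⟨(hy.prodMk hx).aemeasurable, hswap⟩

theorem ae_hasBayesDensity_bayesKernel (hx : Measurable x)
    (hΨ : Measurable (Function.uncurry Ψ)) (hd : Measurable d) (hd0 : ∀ z, d z ≠ 0)
    (hJ : P.map (fun ω ↦ (x ω, y ω)) = bayesJoint Ψ (P.map x) Q₀ d)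
    (hΦΨ : ∀ᵐ z ∂Q₀, ∀ᵐ u ∂(P.map x), Φ u z = Ψ u z) :
    ∀ᵐ z ∂(P.map y), HasBayesDensity (bayesKernel (P.map x) hΨ z) Φ (P.map x) z := by
  have : IsFiniteMeasure (bayesJoint Ψ (P.map x) Q₀ d) := hJ ▸ inferInstance
  have hyac : P.map y ≪ Q₀ := by
    rw [← Measure.snd_map_prodMk hx, hJ, snd_bayesJoint hΨ hd]
    exact withDensity_absolutelyContinuous _ _
  refine hyac.ae_le ?_
  filter_upwards [ae_evidence_lt_top (μ₀ := P.map x) (Q₀ := Q₀) hΨ hd hd0, hΦΨ] with z hz hΦΨz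
  exact hasBayesDensity_bayesKernel hΨ hz hΦΨz

end Posterior

section Hellinger

variable {X : Type*} [MeasurableSpace X]

theorem hellingerDist_eq_of_absolutelyContinuous {μ μ' ρ : Measure X} [IsFiniteMeasure μ]
    [IsFiniteMeasure μ'] [SigmaFinite ρ] (hμ : μ ≪ ρ) (hμ' : μ' ≪ ρ) :
    hellingerDist μ μ' = √((1 / 2) * ∫ u, (√((μ.rnDeriv ρ u).toReal)
      - √((μ'.rnDeriv ρ u).toReal)) ^ 2 ∂ρ) := by
  have hsum : μ + μ' ≪ ρ := Measure.AbsolutelyContinuous.add_left hμ hμ'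
  have hle : μ ≪ μ + μ' := Measure.absolutelyContinuous_of_le (Measure.le_add_right le_rfl)
  have hle' : μ' ≪ μ + μ' := Measure.absolutelyContinuous_of_le (Measure.le_add_left le_rfl)
  rw [hellingerDist, ← integral_rnDeriv_smul hsum]
  congr 2
  refine integral_congr_ae ?_
  filter_upwards [Measure.rnDeriv_mul_rnDeriv (κ := ρ) hle,
    Measure.rnDeriv_mul_rnDeriv (κ := ρ) hle'] with u hu hu'
  rw [← hu, ← hu', Pi.mul_apply, Pi.mul_apply, ENNReal.toReal_mul, ENNReal.toReal_mul,
    Real.sqrt_mul ENNReal.toReal_nonneg, Real.sqrt_mul ENNReal.toReal_nonneg, ← sub_mul, mul_pow,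
    Real.sq_sqrt ENNReal.toReal_nonneg, smul_eq_mul, mul_comm]

end Hellinger

section Elementary

theorem norm_inv_norm_smul_sub_le {E : Type*} [NormedAddCommGroup E] [NormedSpace ℝ E] {f g : E}
    (hf : f ≠ 0) (hg : g ≠ 0) : ‖‖f‖⁻¹ • f - ‖g‖⁻¹ • g‖ ≤ 2 * ‖f - g‖ / ‖f‖ := by
  have hf0 : ‖f‖ ≠ 0 := norm_ne_zero_iff.2 hf
  have hg0 : ‖g‖ ≠ 0 := norm_ne_zero_iff.2 hg
  have hnorm : ‖(‖f‖⁻¹ - ‖g‖⁻¹) • g‖ = |‖g‖ - ‖f‖| / ‖f‖ := by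
    rw [norm_smul, Real.norm_eq_abs, inv_sub_inv hf0 hg0, abs_div, abs_mul, abs_norm, abs_norm]
    field_simp
  calc ‖‖f‖⁻¹ • f - ‖g‖⁻¹ • g‖ = ‖‖f‖⁻¹ • (f - g) + (‖f‖⁻¹ - ‖g‖⁻¹) • g‖ := by
        congr 1
        module
    _ ≤ ‖f‖⁻¹ * ‖f - g‖ + |‖g‖ - ‖f‖| / ‖f‖ := by
        refine (norm_add_le _ _).trans_eq ?_
        rw [hnorm, norm_smul, norm_inv, norm_norm]
    _ ≤ ‖f‖⁻¹ * ‖f - g‖ + ‖f - g‖ / ‖f‖ := by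
        gcongr
        exact (abs_norm_sub_norm_le g f).trans_eq (norm_sub_rev g f)
    _ = 2 * ‖f - g‖ / ‖f‖ := by ring

theorem abs_exp_sub_exp_le {s t m : ℝ} (hs : s ≤ m) (ht : t ≤ m) :
    |Real.exp s - Real.exp t| ≤ Real.exp m * |s - t| :=
  (convex_Iic m).norm_image_sub_le_of_norm_deriv_le (fun a _ ↦ Real.differentiableAt_exp)
    (fun a ha ↦ by simpa using ha) ht hs

theorem exists_one_add_rpow_le_exp_sq {q b : ℝ} (hq : 0 ≤ q) (hb : 0 < b) :
    ∃ D > 0, ∀ t : ℝ, 0 ≤ t → 1 + t ^ q ≤ D * Real.exp (b * t ^ 2) := by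
  obtain ⟨n, hn⟩ := exists_nat_ge q
  refine ⟨2 + n.factorial / b ^ n, by positivity, fun t ht ↦ ?_⟩
  have hrpow : t ^ q ≤ 1 + (t ^ 2) ^ n := by
    rcases le_total t 1 with h | h
    · exact (Real.rpow_le_one ht h hq).trans (le_add_of_nonneg_right (by positivity))
    · calc t ^ q ≤ t ^ n := by
            rw [← Real.rpow_natCast]
            exact Real.rpow_le_rpow_of_exponent_le h hn
        _ ≤ (t ^ 2) ^ n := pow_le_pow_left₀ ht (by nlinarith) n
        _ ≤ 1 + (t ^ 2) ^ n := by linarith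
  have hpow : (t ^ 2) ^ n ≤ n.factorial / b ^ n * Real.exp (b * t ^ 2) := by
    have h := Real.pow_div_factorial_le_exp (b * t ^ 2) (by positivity) n
    rw [mul_pow, div_le_iff₀ (by positivity)] at h
    rw [div_mul_eq_mul_div, le_div_iff₀ (by positivity)]
    linarith
  have hone : 1 ≤ Real.exp (b * t ^ 2) := Real.one_le_exp (by positivity)
  linarith

end Elementary

section Stability

variable {X Y : Type*} [NormedAddCommGroup X] [NormedAddCommGroup Y] {Φ : X → Y → ℝ}

theorem PotentialBounds.continuous (h : PotentialBounds Φ) : Continuous (Function.uncurry Φ) := by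
  rw [continuous_iff_continuousAt]
  rintro ⟨u₀, y₀⟩
  obtain ⟨q, -, hdata⟩ := h.lipschitz_data
  set R : ℝ := ‖u₀‖ + ‖y₀‖ + 1
  have hR : 0 < R := by positivity
  have hu₀ : ‖u₀‖ < R := by linarith [norm_nonneg y₀]
  have hy₀ : ‖y₀‖ < R := by linarith [norm_nonneg u₀]
  obtain ⟨K₂, -, hK₂⟩ := h.lipschitz_state R hR
  obtain ⟨K₃, -, hK₃⟩ := hdata R hR
  rw [ContinuousAt, tendsto_iff_norm_sub_tendsto_zero]
  refine squeeze_zero' (g := fun p : X × Y ↦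
    K₂ * ‖p.1 - u₀‖ + K₃ * (1 + ‖u₀‖ ^ q) * ‖p.2 - y₀‖)
    (Eventually.of_forall fun _ ↦ norm_nonneg _) ?_ ?_
  · have hu : ∀ᶠ p : X × Y in 𝓝 (u₀, y₀), ‖p.1‖ < R :=
      (continuous_fst.norm.tendsto (u₀, y₀)).eventually_lt_const hu₀
    have hy : ∀ᶠ p : X × Y in 𝓝 (u₀, y₀), ‖p.2‖ < R :=
      (continuous_snd.norm.tendsto (u₀, y₀)).eventually_lt_const hy₀
    filter_upwards [hu, hy] with p hpu hpy
    calc ‖Φ p.1 p.2 - Φ u₀ y₀‖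
        ≤ |Φ p.1 p.2 - Φ u₀ p.2| + |Φ u₀ p.2 - Φ u₀ y₀| := abs_sub_le _ _ _
      _ ≤ _ := add_le_add (hK₂ _ _ _ hpu hu₀ hpy) (hK₃ _ _ _ hpy hy₀)
  · have hc : Continuous fun p : X × Y ↦
        K₂ * ‖p.1 - u₀‖ + K₃ * (1 + ‖u₀‖ ^ q) * ‖p.2 - y₀‖ := by fun_prop
    simpa using hc.tendsto (u₀, y₀)

theorem PotentialBounds.exists_abs_exp_neg_half_sub_le (h : PotentialBounds Φ) {C : ℝ}
    (hC : 0 < C) (R : ℝ) :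
    ∃ B ≥ 0, ∀ (u : X) (y y' : Y), ‖y‖ ≤ R → ‖y'‖ ≤ R →
      |Real.exp (-Φ u y / 2) - Real.exp (-Φ u y' / 2)|
        ≤ ‖y - y'‖ * (B * Real.exp (C / 2 * ‖u‖ ^ 2)) := by
  have hR : 0 < |R| + 1 := by positivity
  have hlt : ∀ {z : Y}, ‖z‖ ≤ R → ‖z‖ < |R| + 1 := fun hz ↦
    (hz.trans (le_abs_self R)).trans_lt (lt_add_one _)
  obtain ⟨q, hq, hdata⟩ := h.lipschitz_data
  obtain ⟨K, hK, hlip⟩ := hdata (|R| + 1) hR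
  obtain ⟨M, hM⟩ := h.lower (C / 2) (by positivity) (|R| + 1) hR
  obtain ⟨D, hD, hpow⟩ := exists_one_add_rpow_le_exp_sq hq (b := C / 4) (by positivity)
  refine ⟨Real.exp (-M / 2) * (K * D), by positivity, fun u y y' hy hy' ↦ ?_⟩
  have hhalf : |-Φ u y / 2 - -Φ u y' / 2| ≤ |Φ u y - Φ u y'| := by
    rw [show -Φ u y / 2 - -Φ u y' / 2 = -(Φ u y - Φ u y') / 2 by ring, abs_div, abs_neg, abs_two]
    exact half_le_self (abs_nonneg _)
  calc |Real.exp (-Φ u y / 2) - Real.exp (-Φ u y' / 2)|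
      ≤ Real.exp (-M / 2 + C / 4 * ‖u‖ ^ 2) * |-Φ u y / 2 - -Φ u y' / 2| :=
        abs_exp_sub_exp_le (by linarith [hM u y (hlt hy)]) (by linarith [hM u y' (hlt hy')])
    _ ≤ Real.exp (-M / 2 + C / 4 * ‖u‖ ^ 2) * (K * (1 + ‖u‖ ^ q) * ‖y - y'‖) := by
        gcongr
        exact hhalf.trans (hlip u y y' (hlt hy) (hlt hy'))
    _ ≤ Real.exp (-M / 2 + C / 4 * ‖u‖ ^ 2)
          * (K * (D * Real.exp (C / 4 * ‖u‖ ^ 2)) * ‖y - y'‖) := by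
        gcongr
        exact hpow ‖u‖ (norm_nonneg u)
    _ = ‖y - y'‖ * (Real.exp (-M / 2) * (K * D) * Real.exp (C / 2 * ‖u‖ ^ 2)) := by
        rw [show C / 2 * ‖u‖ ^ 2 = C / 4 * ‖u‖ ^ 2 + C / 4 * ‖u‖ ^ 2 by ring, Real.exp_add,
          Real.exp_add]
        ring

variable [MeasurableSpace X] {μ₀ : Measure X}

/-- The conclusion of Fernique's theorem: some exponential of the squared norm is integrable. -/
def HasExpSqMoment (μ : Measure X) : Prop :=
  ∃ C > 0, Integrable (fun u ↦ Real.exp (C * ‖u‖ ^ 2)) μ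

theorem hasExpSqMoment_of_isGaussian [NormedSpace ℝ X] [CompleteSpace X]
    [SecondCountableTopology X] [BorelSpace X] [IsGaussian μ₀] : HasExpSqMoment μ₀ :=
  IsGaussian.exists_integrable_exp_sq μ₀

theorem memLp_two_of_abs_le_exp_sq {f : X → ℝ} (hf : AEStronglyMeasurable f μ₀) {D C : ℝ}
    (hint : Integrable (fun u ↦ Real.exp (C * ‖u‖ ^ 2)) μ₀)
    (h : ∀ u, |f u| ≤ D * Real.exp (C / 2 * ‖u‖ ^ 2)) : MemLp f 2 μ₀ := by
  rw [memLp_two_iff_integrable_sq hf]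
  refine (hint.const_mul (D ^ 2)).mono' (hf.pow 2) (ae_of_all _ fun u ↦ ?_)
  rw [Real.norm_of_nonneg (sq_nonneg _), ← sq_abs]
  calc |f u| ^ 2 ≤ (D * Real.exp (C / 2 * ‖u‖ ^ 2)) ^ 2 := by
        gcongr
        exact h u
    _ = D ^ 2 * Real.exp (C * ‖u‖ ^ 2) := by
        rw [mul_pow, ← Real.exp_nat_mul]
        congr 2
        push_cast
        ring

variable [OpensMeasurableSpace X]

theorem PotentialBounds.memLp_exp_neg_half (h : PotentialBounds Φ) (hμ₀ : HasExpSqMoment μ₀)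
    (y : Y) : MemLp (fun u ↦ Real.exp (-Φ u y / 2)) 2 μ₀ := by
  obtain ⟨C, hC, hint⟩ := hμ₀
  obtain ⟨M, hM⟩ := h.lower C hC (‖y‖ + 1) (by positivity)
  have hcont : Continuous fun u ↦ Φ u y := h.continuous.comp (by fun_prop : Continuous (·, y))
  refine memLp_two_of_abs_le_exp_sq (D := Real.exp (-M / 2))
    (by fun_prop : Continuous _).measurable.aestronglyMeasurable hint fun u ↦ ?_
  rw [Real.abs_exp, ← Real.exp_add, Real.exp_le_exp]
  linarith [hM u y (lt_add_one _)]

/-- The square root `exp (-Φ(·; y) / 2)` of the likelihood as an element of `L²(μ₀)`; after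
normalisation it is the square root of the posterior density. -/
noncomputable def PotentialBounds.sqrtLikelihood (h : PotentialBounds Φ)
    (hμ₀ : HasExpSqMoment μ₀) (y : Y) : Lp ℝ 2 μ₀ :=
  (h.memLp_exp_neg_half hμ₀ y).toLp _

theorem PotentialBounds.coeFn_sqrtLikelihood (h : PotentialBounds Φ) (hμ₀ : HasExpSqMoment μ₀)
    (y : Y) : h.sqrtLikelihood hμ₀ y =ᵐ[μ₀] fun u ↦ Real.exp (-Φ u y / 2) :=
  MemLp.coeFn_toLp _

theorem exp_half_sq (a : ℝ) : Real.exp (a / 2) ^ 2 = Real.exp a := by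
  rw [Real.exp_half, Real.sq_sqrt (Real.exp_pos a).le]

theorem PotentialBounds.evidence_eq (h : PotentialBounds Φ) (hμ₀ : HasExpSqMoment μ₀) (y : Y) :
    evidence Φ μ₀ y = ENNReal.ofReal (‖h.sqrtLikelihood hμ₀ y‖ ^ 2) := by
  have hint : Integrable (fun u ↦ Real.exp (-Φ u y)) μ₀ := by
    simpa only [exp_half_sq] using (h.memLp_exp_neg_half hμ₀ y).integrable_sq
  rw [evidence, ← ofReal_integral_eq_lintegral_ofReal hint
    (ae_of_all _ fun u ↦ (Real.exp_pos _).le), ← real_inner_self_eq_norm_sq, L2.inner_def]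
  congr 1
  refine integral_congr_ae ?_
  filter_upwards [h.coeFn_sqrtLikelihood hμ₀ y] with u hu
  rw [hu, real_inner_self_eq_norm_sq, Real.norm_eq_abs, sq_abs, exp_half_sq]

theorem PotentialBounds.evidence_lt_top (h : PotentialBounds Φ) (hμ₀ : HasExpSqMoment μ₀)
    (y : Y) : evidence Φ μ₀ y < ∞ := by
  rw [h.evidence_eq hμ₀]
  exact ENNReal.ofReal_lt_top

theorem PotentialBounds.exists_le_evidence [NeZero μ₀] (h : PotentialBounds Φ) (R : ℝ) :
    ∃ I > 0, ∀ y, ‖y‖ ≤ R → I ≤ evidence Φ μ₀ y := by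
  obtain ⟨p, -, hupper⟩ := h.upper
  obtain ⟨K, -, hK⟩ := hupper (|R| + 1) (by positivity)
  refine ⟨evidence (fun u _ ↦ K * (1 + ‖u‖ ^ p)) μ₀ (0 : Y), evidence_pos (by fun_prop),
    fun y hy ↦ lintegral_mono fun u ↦ ?_⟩
  gcongr
  exact hK u y (by linarith [le_abs_self R])

theorem PotentialBounds.exists_le_norm_sqrtLikelihood [NeZero μ₀] (h : PotentialBounds Φ)
    (hμ₀ : HasExpSqMoment μ₀) (R : ℝ) :
    ∃ κ > 0, ∀ y, ‖y‖ ≤ R → κ ≤ ‖h.sqrtLikelihood hμ₀ y‖ := by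
  obtain ⟨I, hI, hle⟩ := h.exists_le_evidence (μ₀ := μ₀) R
  obtain ⟨J, hJ, hJI, hJtop⟩ : ∃ J, 0 < J ∧ J ≤ I ∧ J ≠ ∞ :=
    ⟨min I 1, lt_min hI one_pos, min_le_left _ _, ne_top_of_le_ne_top ENNReal.one_ne_top
      (min_le_right _ _)⟩
  refine ⟨√J.toReal, Real.sqrt_pos.2 (ENNReal.toReal_pos hJ.ne' hJtop), fun y hy ↦ ?_⟩
  rw [Real.sqrt_le_left (norm_nonneg _), ← ENNReal.le_ofReal_iff_toReal_le hJtop (by positivity),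
    ← h.evidence_eq hμ₀]
  exact hJI.trans (hle y hy)

theorem PotentialBounds.exists_norm_sqrtLikelihood_sub_le (h : PotentialBounds Φ)
    (hμ₀ : HasExpSqMoment μ₀) (R : ℝ) :
    ∃ L ≥ 0, ∀ y y' : Y, ‖y‖ ≤ R → ‖y'‖ ≤ R →
      ‖h.sqrtLikelihood hμ₀ y - h.sqrtLikelihood hμ₀ y'‖ ≤ L * ‖y - y'‖ := by
  obtain ⟨C, hC, hint⟩ := id hμ₀
  obtain ⟨B, hB, hpoint⟩ := h.exists_abs_exp_neg_half_sub_le hC R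
  have hpos : ∀ u : X, 0 ≤ B * Real.exp (C / 2 * ‖u‖ ^ 2) := fun u ↦ by positivity
  have hmem : MemLp (fun u : X ↦ B * Real.exp (C / 2 * ‖u‖ ^ 2)) 2 μ₀ :=
    memLp_two_of_abs_le_exp_sq (by fun_prop) hint fun u ↦ (abs_of_nonneg (hpos u)).le
  refine ⟨‖hmem.toLp _‖, norm_nonneg _, fun y y' hy hy' ↦ ?_⟩
  rw [mul_comm]
  refine Lp.norm_le_mul_norm_of_ae_le_mul ?_
  filter_upwards [Lp.coeFn_sub (h.sqrtLikelihood hμ₀ y) (h.sqrtLikelihood hμ₀ y'),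
    h.coeFn_sqrtLikelihood hμ₀ y, h.coeFn_sqrtLikelihood hμ₀ y', hmem.coeFn_toLp]
    with u hsub hu hu' hbound
  rw [hsub, Pi.sub_apply, hu, hu', hbound, Real.norm_eq_abs, Real.norm_of_nonneg (hpos u)]
  exact hpoint u y y' hy hy'

theorem PotentialBounds.sqrt_toReal_exp_neg_div_evidence (h : PotentialBounds Φ)
    (hμ₀ : HasExpSqMoment μ₀) (y : Y) (u : X) :
    √(ENNReal.ofReal (Real.exp (-Φ u y)) / evidence Φ μ₀ y).toReal
      = ‖h.sqrtLikelihood hμ₀ y‖⁻¹ * Real.exp (-Φ u y / 2) := by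
  rw [h.evidence_eq hμ₀, ENNReal.toReal_div, ENNReal.toReal_ofReal (Real.exp_pos _).le,
    ENNReal.toReal_ofReal (by positivity), ← exp_half_sq, ← div_pow,
    Real.sqrt_sq (by positivity), div_eq_inv_mul]

theorem PotentialBounds.hellingerDist_eq [SigmaFinite μ₀] (h : PotentialBounds Φ)
    (hμ₀ : HasExpSqMoment μ₀) {y y' : Y} {μ μ' : Measure X}
    [IsFiniteMeasure μ] [IsFiniteMeasure μ'] (hμ : HasBayesDensity μ Φ μ₀ y)
    (hμ' : HasBayesDensity μ' Φ μ₀ y') :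
    hellingerDist μ μ' = √((1 / 2) *
      ‖‖h.sqrtLikelihood hμ₀ y‖⁻¹ • h.sqrtLikelihood hμ₀ y
        - ‖h.sqrtLikelihood hμ₀ y'‖⁻¹ • h.sqrtLikelihood hμ₀ y'‖ ^ 2) := by
  rw [hellingerDist_eq_of_absolutelyContinuous hμ.1 hμ'.1, ← real_inner_self_eq_norm_sq,
    L2.inner_def]
  congr 2
  refine integral_congr_ae ?_
  filter_upwards [hμ.2, hμ'.2, Lp.coeFn_sub
      (‖h.sqrtLikelihood hμ₀ y‖⁻¹ • h.sqrtLikelihood hμ₀ y)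
      (‖h.sqrtLikelihood hμ₀ y'‖⁻¹ • h.sqrtLikelihood hμ₀ y'),
    Lp.coeFn_smul ‖h.sqrtLikelihood hμ₀ y‖⁻¹ (h.sqrtLikelihood hμ₀ y),
    Lp.coeFn_smul ‖h.sqrtLikelihood hμ₀ y'‖⁻¹ (h.sqrtLikelihood hμ₀ y'),
    h.coeFn_sqrtLikelihood hμ₀ y, h.coeFn_sqrtLikelihood hμ₀ y']
    with u hderiv hderiv' hsub hsmul hsmul' hu hu'
  rw [hderiv, hderiv', hsub, Pi.sub_apply, hsmul, hsmul', Pi.smul_apply, Pi.smul_apply, hu, hu',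
    h.sqrt_toReal_exp_neg_div_evidence hμ₀, h.sqrt_toReal_exp_neg_div_evidence hμ₀,
    real_inner_self_eq_norm_sq, Real.norm_eq_abs, sq_abs, smul_eq_mul, smul_eq_mul]

theorem PotentialBounds.exists_hellingerDist_le [NeZero μ₀] [SigmaFinite μ₀]
    (h : PotentialBounds Φ) (hμ₀ : HasExpSqMoment μ₀) {post : Y → Measure X}
    [∀ y, IsFiniteMeasure (post y)] (hpost : ∀ y, HasBayesDensity (post y) Φ μ₀ y) (R : ℝ) :
    ∃ C > 0, ∀ y y' : Y, ‖y‖ ≤ R → ‖y'‖ ≤ R →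
      hellingerDist (post y) (post y') ≤ C * ‖y - y'‖ := by
  obtain ⟨κ, hκ, hle⟩ := h.exists_le_norm_sqrtLikelihood hμ₀ R
  obtain ⟨L, hL, hlip⟩ := h.exists_norm_sqrtLikelihood_sub_le hμ₀ R
  have hne : ∀ z, ‖z‖ ≤ R → h.sqrtLikelihood hμ₀ z ≠ 0 := fun z hz ↦
    norm_pos_iff.1 (hκ.trans_le (hle z hz))
  refine ⟨2 * L / κ + 1, by positivity, fun y y' hy hy' ↦ ?_⟩
  set N := ‖‖h.sqrtLikelihood hμ₀ y‖⁻¹ • h.sqrtLikelihood hμ₀ y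
    - ‖h.sqrtLikelihood hμ₀ y'‖⁻¹ • h.sqrtLikelihood hμ₀ y'‖
  have hN : 0 ≤ N := norm_nonneg _
  calc hellingerDist (post y) (post y') = √(1 / 2 * N ^ 2) :=
        h.hellingerDist_eq hμ₀ (hpost y) (hpost y')
    _ ≤ N := Real.sqrt_le_iff.2 ⟨hN, by nlinarith [sq_nonneg N]⟩
    _ ≤ 2 * ‖h.sqrtLikelihood hμ₀ y - h.sqrtLikelihood hμ₀ y'‖ / ‖h.sqrtLikelihood hμ₀ y‖ :=
        norm_inv_norm_smul_sub_le (hne y hy) (hne y' hy')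
    _ ≤ 2 * (L * ‖y - y'‖) / κ := by
        gcongr
        · exact hlip y y' hy hy'
        · exact hle y hy
    _ = 2 * L / κ * ‖y - y'‖ := by ring
    _ ≤ (2 * L / κ + 1) * ‖y - y'‖ := by
        gcongr
        exact le_add_of_nonneg_right zero_le_one

end Stability

theorem absolutelyContinuous_of_rnDeriv_ne_zero {Y : Type*} [MeasurableSpace Y]
    {μ ν : Measure Y} (h : ∀ᵐ z ∂ν, μ.rnDeriv ν z ≠ 0) : ν ≪ μ :=
  (withDensity_absolutelyContinuous' (Measure.measurable_rnDeriv μ ν).aemeasurable h).trans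
    (Measure.absolutelyContinuous_of_le (Measure.withDensity_rnDeriv_le μ ν))

theorem IsGaussianWith.absolutelyContinuous_of_rnDeriv_ne_zero {Y ι : Type*}
    [NormedAddCommGroup Y] [InnerProductSpace ℝ Y] [CompleteSpace Y] [SecondCountableTopology Y]
    [MeasurableSpace Y] [BorelSpace Y] {μ ν : Measure Y} [IsGaussian ν] {a : Y} {C : Y →L[ℝ] Y}
    {e : HilbertBasis ι ℝ Y} {r lam : ι → ℝ} (hμ : IsGaussianWith μ a C)
    (hC : ∀ k, C (e k) = r k • e k) (hν : ∀ k, covOp id ν (e k) = lam k • e k)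
    (h : ∀ᵐ z ∂ν, μ.rnDeriv ν z ≠ 0) : μ ≪ ν := by
  have : IsGaussian μ := hμ.1
  exact absolutelyContinuous_of_absolutelyContinuous_gaussian (fun k ↦ by rw [hμ.2.2, hC k]) hν
    (BayesModelError.absolutelyContinuous_of_rnDeriv_ne_zero h)

theorem exists_measurable_potential {X Y : Type*} [NormedAddCommGroup X]
    [SecondCountableTopology X] [MeasurableSpace X] [OpensMeasurableSpace X]
    [NormedAddCommGroup Y] [MeasurableSpace Y] [OpensMeasurableSpace Y]
    {Φ : X → Y → ℝ} {ρ : Measure (X × Y)} (hΦ : AEMeasurable (fun p : X × Y ↦ Φ p.1 p.2) ρ) :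
    ∃ Ψ : X → Y → ℝ, Measurable (Function.uncurry Ψ) ∧ (∀ᵐ p ∂ρ, Φ p.1 p.2 = Ψ p.1 p.2) ∧
      (PotentialBounds Φ → Ψ = Φ) := by
  by_cases h : PotentialBounds Φ
  · exact ⟨Φ, h.continuous.measurable, ae_of_all _ fun _ ↦ rfl, fun _ ↦ rfl⟩
  · exact ⟨fun u z ↦ hΦ.mk _ (u, z), hΦ.measurable_mk, hΦ.ae_eq_mk, fun h' ↦ absurd h' h⟩

end BayesModelError

open BayesModelError in
theorem mainTheorem10_general
    {Ω X Y ι : Type*} [MeasurableSpace Ω]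
    [NormedAddCommGroup X] [InnerProductSpace ℝ X] [CompleteSpace X]
    [SecondCountableTopology X] [MeasurableSpace X] [BorelSpace X]
    [NormedAddCommGroup Y] [InnerProductSpace ℝ Y] [CompleteSpace Y]
    [SecondCountableTopology Y] [MeasurableSpace Y] [BorelSpace Y]
    (P : Measure Ω) [IsProbabilityMeasure P]
    (x : Ω → X) (ε η y : Ω → Y) (G : X → Y)
    (hx : Measurable x) (hε : Measurable ε) (hη : Measurable η) (hG : Measurable G)
    (hy : ∀ ω, y ω = G (x ω) + ε ω + η ω)
    (hgauss : HasGaussianLaw (fun ω ↦ (ε ω, x ω)) P)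
    (hηgauss : HasGaussianLaw η P) (hη0 : ∫ ω, η ω ∂P = 0)
    (hindep : IndepFun η (fun ω ↦ (ε ω, x ω)) P)
    (e : HilbertBasis ι ℝ Y) (lam r : ι → ℝ)
    (hlam_eig : ∀ k, covOp η P (e k) = lam k • e k)
    (hr_eig : ∀ k, condNoiseCov x ε η P (e k) = r k • e k)
    (Φ : X → Y → ℝ) (c : Y → ℝ)
    (hΦmeas : AEMeasurable (fun p : X × Y ↦ Φ p.1 p.2) ((P.map x).prod (P.map η)))
    (hcmeas : AEMeasurable c (P.map η)) (hcpos : ∀ᵐ z ∂(P.map η), 0 < c z)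
    (hΦ : ∀ᵐ u ∂(P.map x), (condDistrib y x P u).rnDeriv (P.map η)
      =ᵐ[P.map η] fun z ↦ ENNReal.ofReal (Real.exp (-Φ u z) / c z)) :
    (∀ᵐ u ∂(P.map x),
      IsGaussianWith (condDistrib y x P u)
        (G u + condMean x ε P u) (condNoiseCov x ε η P) ∧
      condDistrib y x P u ≪ P.map η) ∧
    ∃ post : Kernel Y X, IsMarkovKernel post ∧ HasCondDistrib x y post P ∧
      (∀ᵐ z ∂(P.map y), HasBayesDensity (post z) Φ (P.map x) z) ∧
      (PotentialBounds Φ →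
        (∀ z, HasBayesDensity (post z) Φ (P.map x) z) ∧
        ∀ R > (0 : ℝ), ∃ C > (0 : ℝ), ∀ z z' : Y, ‖z‖ ≤ R → ‖z'‖ ≤ R →
          hellingerDist (post z) (post z') ≤ C * ‖z - z'‖) := by
  have : IsGaussian (P.map x) := hgauss.snd.isGaussian_map
  have : IsGaussian (P.map η) := hηgauss.isGaussian_map
  have hym : Measurable y := funext hy ▸ ((hG.comp hx).add hε).add hη
  have hlaw := isGaussianWith_condDistrib hx hε hη hG hy hgauss hηgauss hη0 hindep
  have hac : ∀ᵐ u ∂(P.map x), condDistrib y x P u ≪ P.map η := by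
    filter_upwards [hlaw, hΦ] with u hu hΦu
    refine hu.absolutelyContinuous_of_rnDeriv_ne_zero hr_eig
      (fun k ↦ by rw [covOp_map_id hη.aemeasurable, hlam_eig]) ?_
    filter_upwards [hΦu, hcpos] with z hz hcz
    exact hz ▸ (ENNReal.ofReal_pos.2 (div_pos (Real.exp_pos _) hcz)).ne'
  obtain ⟨Ψ, hΨ, hΦΨ, hΨ_eq⟩ := exists_measurable_potential hΦmeas
  obtain ⟨d, hd, hd0, hjoint⟩ := exists_compProd_eq_bayesJoint hΨ
    (Measure.ae_ae_of_ae_prod hΦΨ) hcmeas hcpos hac hΦ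
  rw [compProd_map_condDistrib hym.aemeasurable] at hjoint
  refine ⟨hlaw.and hac, bayesKernel (P.map x) hΨ, inferInstance,
    hasCondDistrib_bayesKernel hx hym hΨ hd hd0 hjoint,
    ae_hasBayesDensity_bayesKernel hx hΨ hd hd0 hjoint (ae_ae_swap_of_ae_prod hΦΨ), fun hb ↦ ?_⟩
  obtain rfl := hΨ_eq hb
  have hpost z : HasBayesDensity (bayesKernel (P.map x) hΨ z) Ψ (P.map x) z :=
    hasBayesDensity_bayesKernel hΨ (hb.evidence_lt_top hasExpSqMoment_of_isGaussian z) (by simp)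
  exact ⟨hpost, fun R _ ↦ hb.exists_hellingerDist_le hasExpSqMoment_of_isGaussian hpost R⟩

theorem mainTheorem10
    {Ω X Y ι : Type*} [MeasurableSpace Ω]
    [NormedAddCommGroup X] [InnerProductSpace ℝ X] [CompleteSpace X]
    [SecondCountableTopology X] [MeasurableSpace X] [BorelSpace X]
    [NormedAddCommGroup Y] [InnerProductSpace ℝ Y] [CompleteSpace Y]
    [SecondCountableTopology Y] [MeasurableSpace Y] [BorelSpace Y]
    (P : Measure Ω) [IsProbabilityMeasure P]
    -- the unknown `x`, the model error `ε`, the noise `η` and the data `y = G_a(x) + ε + η`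
    (x : Ω → X) (ε η y : Ω → Y) (G : X → Y)
    (hx : Measurable x) (hε : Measurable ε) (hη : Measurable η) (hG : Measurable G)
    (hy : ∀ ω, y ω = G (x ω) + ε ω + η ω)
    (hgauss : HasGaussianLaw (fun ω ↦ (ε ω, x ω)) P)
    (hηgauss : HasGaussianLaw η P) (hη0 : ∫ ω, η ω ∂P = 0)
    (hindep : IndepFun η (fun ω ↦ (ε ω, x ω)) P)
    -- commuting covariances, diagonalised by the orthonormal basis `e`
    (hcomm : Commute (BayesModelError.covOp η P) (BayesModelError.condNoiseCov x ε η P))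
    (e : HilbertBasis ι ℝ Y) (lam r : ι → ℝ)
    (hlam : ∀ k, 0 < lam k) (hr : ∀ k, 0 < r k)
    (hlam_eig : ∀ k, BayesModelError.covOp η P (e k) = lam k • e k)
    (hr_eig : ∀ k, BayesModelError.condNoiseCov x ε η P (e k) = r k • e k)
    (hmean : ∀ᵐ u ∂(P.map x), Summable fun k ↦
      (inner ℝ (G u + BayesModelError.condMean x ε P u) (e k)) ^ 2 / (lam k + r k))
    (hcov : Summable fun k ↦ (lam k - r k) ^ 2 / (lam k + r k) ^ 2)
    -- the potential: `dQ̃/dQ₀ (y) = exp (-Φ(u; y)) / c(y)`, `Q̃` the law of `y` given `x = u`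
    (Φ : X → Y → ℝ) (c : Y → ℝ)
    (hΦmeas : AEMeasurable (fun p : X × Y ↦ Φ p.1 p.2) ((P.map x).prod (P.map η)))
    (hcmeas : AEMeasurable c (P.map η)) (hcpos : ∀ᵐ z ∂(P.map η), 0 < c z)
    (hΦ : ∀ᵐ u ∂(P.map x), (condDistrib y x P u).rnDeriv (P.map η)
      =ᵐ[P.map η] fun z ↦ ENNReal.ofReal (Real.exp (-Φ u z) / c z))
    (hZ : ∀ᵐ z ∂(P.map η), 0 < BayesModelError.evidence Φ (P.map x) z) :
    -- the law of `y` given `x = u` is `N(h(u), C_{ν|x})`, absolutely continuous w.r.t. `Q₀`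
    (∀ᵐ u ∂(P.map x),
      BayesModelError.IsGaussianWith (condDistrib y x P u)
        (G u + BayesModelError.condMean x ε P u) (BayesModelError.condNoiseCov x ε η P) ∧
      condDistrib y x P u ≪ P.map η) ∧
    -- the posterior
    ∃ post : Kernel Y X, IsMarkovKernel post ∧ HasCondDistrib x y post P ∧
      (∀ᵐ z ∂(P.map y), BayesModelError.HasBayesDensity (post z) Φ (P.map x) z) ∧
      (BayesModelError.PotentialBounds Φ →
        (∀ z, BayesModelError.HasBayesDensity (post z) Φ (P.map x) z) ∧
        ∀ R > (0 : ℝ), ∃ C > (0 : ℝ), ∀ z z' : Y, ‖z‖ ≤ R → ‖z'‖ ≤ R →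
          BayesModelError.hellingerDist (post z) (post z') ≤ C * ‖z - z'‖) :=
  mainTheorem10_general P x ε η y G hx hε hη hG hy hgauss hηgauss hη0 hindep e lam r
    hlam_eig hr_eig Φ c hΦmeas hcmeas hcpos hΦ
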